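/- Let $\Gamma$ be a finite connected bipartite distance-regular graph with vertex set $X$, path-length distance $\partial$, diameter $D\ge 4$ and valency $k\ge 3$. Let $p^h_{ij}$ be its intersection numbers, so that $p^h_{ij}=|\{z\in X:\partial(y,z)=i,\ \partial(z,y')=j\}|$ whenever $\partial(y,y')=h$, and put $c_i=p^i_{1,i-1}$ $(1\le i\le D)$, $b_i=p^i_{1,i+1}$ $(0\le i\le D-1)$, $c_0=b_D=0$, and $k_i=p^0_{ii}$ $(0\le i\le D)$, so $k=b_0$. For $0\le i\le D$ let $A_i$ be the $i$-th distance matrix (the complex $X\times X$ matrix whose $(y,z)$ entry is $1$ if $\partial(y,z)=i$ and $0$ otherwise), let $A=A_1$, and let $\theta_0>\theta_1>\cdots>\theta_D$ be the distinct eigenvalues of $A$. Put $d=\lfloor D/2\rfloor$ and $$\tilde\theta_i=-1-\frac{b_2b_3}{\theta_i^2-b_2}\qquad(i\in\{1,d\}).$$ Define polynomials in $\mathbb R[\lambda]$ as follows. Let $f_{-1}=0$, $f_0=1$ and $\lambda f_i=b_{i-1}f_{i-1}+c_{i+1}f_{i+1}$ $(0\le i\le D-1)$. For $0\le i\le D$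 let $p_i=\sum_{0\le h\le i,\ i-h\text{ even}}f_h$, and let $P_i$ be the polynomial with $p_i(\lambda)=P_i(\lambda^2)$ if $i$ is even and $p_i(\lambda)=\lambda P_i(\lambda^2)$ if $i$ is odd. Fix $x\in X$. For $0\le i\le D$ let $E_i^*$ be the diagonal $X\times X$ matrix whose $(y,y)$ entry is $1$ if $\partial(x,y)=i$ and $0$ otherwise. Let $T$ be the subalgebra of $\mathrm{Mat}_X(\mathbb C)$ generated by $A,E_0^*,\dots,E_D^*$; it acts on $V=\mathbb C^X$, which carries the standard Hermitian inner product. A $T$-module is a subspace of $V$ stable under $T$; it is irreducible if it is nonzero and contains no $T$-modules other than $0$ and itself. Let $W$ be an irreducible $T$-module that is thin ($\dim E_i^*W\le 1$ for all $i$) and has endpoint $2$ (that is, $\min\{i:E_i^*W\ne0\}=2$). Let $\eta\in\mathbb R$ be its local eigenvalue, i.e. the eigenvalue of $E_2^*A_2E_2^*$ on the one-dimensional space $E_2^*W$. Assume $\tilde\theta_1<\eta<\tilde\theta_d$, and let $v$ be a nonzero vector in $E_2^*W$. **Theorem.** The vectors $$E_{i+2}^*A_iv\qquad(0\le i\le D-2)$$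 form a basis of $W$ and are mutually orthogonal. Moreover: (i) Suppose $\eta\ne-1$, and put $\psi=b_2\bigl(1-\frac{b_3}{1+\eta}\bigr)$. Then $\psi\ne b_2$, $P_i(\psi)\neq0$ for $0\le i\le D$, and for $0\le i\le D-2$ $$E_{i+2}^*A_iv=\sum_{\substack{0\le h\le i\\ i-h\text{ even}}}\frac{P_h(\psi)}{P_i(\psi)}\,\frac{k_ib_ib_{i+1}}{k_hb_hb_{h+1}}\,p_h(A)v,$$ $$\|E_{i+2}^*A_iv\|^2=\frac{k_ib_ib_{i+1}c_{i+1}c_{i+2}}{k\,b_1(\psi-b_2)}\,\frac{P_{i+2}(\psi)}{P_i(\psi)}\,\|v\|^2 .$$ (ii) Suppose $\eta=-1$. Then for $0\le i\le D-2$ $$E_{i+2}^*A_iv=p_i(A)v,\qquad \|E_{i+2}^*A_iv\|^2=\frac{k_ib_ib_{i+1}}{k\,b_1}\,\|v\|^2 .$$ -/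

import Mathlib

namespace DRG

open Polynomial

variable {X : Type*} [Fintype X]

/-- `|{z | ∂(x,z) = i, ∂(z,y) = j}|`. -/
noncomputable def sphereCount (G : SimpleGraph X) (i j : ℕ) (x y : X) : ℕ :=
  (Finset.univ.filter fun z : X => G.dist x z = i ∧ G.dist z y = j).card

/-- `G` is connected and `|{z | ∂(x,z) = i, ∂(z,y) = j}|` depends only on `i`, `j` and
`∂(x,y)`. -/
def IsDistanceRegular (G : SimpleGraph X) : Prop :=
  G.Connected ∧ ∀ i j : ℕ, ∀ x y x' y' : X, G.dist x y = G.dist x' y' →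
    sphereCount G i j x y = sphereCount G i j x' y'

/-- The intersection number `p^h_{ij}`: the common value of `sphereCount G i j x y` over the
pairs with `∂(x,y) = h` (written as the largest value; it is `0` if there is no such pair). -/
noncomputable def intersectionNumber (G : SimpleGraph X) (h i j : ℕ) : ℕ :=
  (Finset.univ.filter fun q : X × X => G.dist q.1 q.2 = h).sup
    fun q => sphereCount G i j q.1 q.2

theorem sphereCount_eq_intersectionNumber {G : SimpleGraph X} (hG : IsDistanceRegular G)
    (i j : ℕ) (x y : X) :
    sphereCount G i j x y = intersectionNumber G (G.dist x y) i j := by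
  apply le_antisymm
  · exact Finset.le_sup (f := fun q : X × X => sphereCount G i j q.1 q.2)
      (b := (x, y)) (by simp)
  · refine Finset.sup_le fun q hq => ?_
    simp only [Finset.mem_filter, Finset.mem_univ, true_and] at hq
    exact (hG.2 i j q.1 q.2 x y hq).le

/-- `c_i = p^i_{1,i-1}`, with `c_0 = 0`. -/
noncomputable def c (G : SimpleGraph X) (i : ℕ) : ℕ :=
  if i = 0 then 0 else intersectionNumber G i 1 (i - 1)

/-- `b_i = p^i_{1,i+1}`; for `i` the diameter this is `0`. -/
noncomputable def b (G : SimpleGraph X) (i : ℕ) : ℕ := intersectionNumber G i 1 (i + 1)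

/-- The `i`-th valency `k_i = p^0_{ii}`. -/
noncomputable def kk (G : SimpleGraph X) (i : ℕ) : ℕ := intersectionNumber G 0 i i

/-- The valency `k = b_0`. -/
noncomputable def valency (G : SimpleGraph X) : ℕ := b G 0

/-- `z ↦ -1 - b_2 b_3 / (z² - b_2)`, used for real `z` with `z² ≠ b_2`. -/
noncomputable def tilde (G : SimpleGraph X) (z : ℝ) : ℝ :=
  -1 - (b G 2 : ℝ) * (b G 3 : ℝ) / (z ^ 2 - (b G 2 : ℝ))

/-- The polynomials `f_i`: `f_0 = 1` and `λ f_i = b_{i-1} f_{i-1} + c_{i+1} f_{i+1}`, where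
`f_{-1} = 0`. -/
noncomputable def f (G : SimpleGraph X) : ℕ → ℝ[X]
  | 0 => 1
  | 1 => C ((c G 1 : ℝ)⁻¹) * Polynomial.X
  | (i + 2) => C ((c G (i + 2) : ℝ)⁻¹) * (Polynomial.X * f G (i + 1) - C (b G i : ℝ) * f G i)

/-- `p_i = f_i + f_{i-2} + f_{i-4} + ⋯`, ending in `f_0` or `f_1`. -/
noncomputable def p (G : SimpleGraph X) (i : ℕ) : ℝ[X] :=
  ∑ h ∈ (Finset.range (i + 1)).filter (fun h => Even (i - h)), f G h

/-- The polynomial `P_i` with `p_i(λ) = P_i(λ²)` for even `i` and `p_i(λ) = λ P_i(λ²)` for odd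
`i` (see `p_eq`). -/
noncomputable def P (G : SimpleGraph X) (i : ℕ) : ℝ[X] :=
  if Even i then contract 2 (p G i) else contract 2 (divX (p G i))

theorem f_coeff (G : SimpleGraph X) : ∀ i n : ℕ, Odd (n + i) → (f G i).coeff n = 0
  | 0, n, h => by
    have : n ≠ 0 := by rintro rfl; simp at h
    simp [f, coeff_one, this]
  | 1, n, h => by
    have : 1 ≠ n := by rintro rfl; revert h; decide
    simp [f, coeff_X, this]
  | (i + 2), n, h => by
    have h0 := f_coeff G i n (by grind)
    rw [f, coeff_C_mul, coeff_sub, coeff_C_mul, h0]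
    cases n with
    | zero => simp
    | succ n =>
      rw [coeff_X_mul, f_coeff G (i + 1) n (by grind)]
      simp

theorem p_coeff (G : SimpleGraph X) (i n : ℕ) (h : Odd (n + i)) : (p G i).coeff n = 0 := by
  rw [p, finsetSum_coeff]
  refine Finset.sum_eq_zero fun j hj => f_coeff G j n ?_
  simp only [Finset.mem_filter, Finset.mem_range] at hj
  grind

theorem p_eq (G : SimpleGraph X) (i : ℕ) :
    p G i = if Even i then (P G i).comp (Polynomial.X ^ 2)
      else Polynomial.X * (P G i).comp (Polynomial.X ^ 2) := by
  have key : ∀ q : ℝ[X], (∀ n, Odd n → q.coeff n = 0) →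
      q = (contract 2 q).comp (Polynomial.X ^ 2) := by
    intro q hq
    rw [← expand_eq_comp_X_pow]
    ext n
    rw [coeff_expand two_pos, coeff_contract two_ne_zero]
    split_ifs with h
    · rw [Nat.div_mul_cancel h]
    · exact hq n (by grind)
  by_cases h : Even i
  · rw [if_pos h, P, if_pos h]
    exact key _ fun n hn => p_coeff G i n (by grind)
  · rw [if_neg h, P, if_neg h, ← key _ fun n hn => ?_]
    · conv_lhs => rw [← X_mul_divX_add (p G i), p_coeff G i 0 (by grind)]
      simp
    · rw [coeff_divX]
      exact p_coeff G i _ (by grind)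

/-- The `i`-th distance matrix `A_i`. -/
noncomputable def distMatrix (G : SimpleGraph X) (i : ℕ) : Matrix X X ℂ :=
  Matrix.of fun x y => if G.dist x y = i then 1 else 0

/-- The adjacency matrix `A = A_1`. -/
noncomputable def adj (G : SimpleGraph X) : Matrix X X ℂ := distMatrix G 1

variable [DecidableEq X]

/-- `θ_i`: the distinct real eigenvalues of `A`, listed in decreasing order from `i = 0`. -/
noncomputable def theta (G : SimpleGraph X) (i : ℕ) : ℝ :=
  ((adj G).finite_real_spectrum.toFinset.sort (· ≥ ·)).getD i 0

/-- The `i`-th dual idempotent `E*_i` with respect to `x`. -/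
noncomputable def dualIdem (G : SimpleGraph X) (x : X) (i : ℕ) : Matrix X X ℂ :=
  Matrix.diagonal fun y => if G.dist x y = i then 1 else 0

/-- The Bose-Mesner algebra `M`, generated by `A`. -/
noncomputable def boseMesner (G : SimpleGraph X) : Subalgebra ℂ (Matrix X X ℂ) :=
  Algebra.adjoin ℂ {adj G}

/-- The dual Bose-Mesner algebra `M*` with respect to `x`, generated by the `E*_i`. -/
noncomputable def dualBoseMesner (G : SimpleGraph X) (x : X) : Subalgebra ℂ (Matrix X X ℂ) :=
  Algebra.adjoin ℂ (Set.range (dualIdem G x))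

/-- The subconstituent algebra `T` with respect to `x`, generated by `M` and `M*`. -/
noncomputable def subconstituentAlgebra (G : SimpleGraph X) (x : X) : Subalgebra ℂ (Matrix X X ℂ) :=
  boseMesner G ⊔ dualBoseMesner G x

/-- The action of a matrix on the standard module `V = ℂ^X` with its Hermitian inner product. -/
noncomputable def act (B : Matrix X X ℂ) : EuclideanSpace ℂ X →ₗ[ℂ] EuclideanSpace ℂ X :=
  Matrix.toEuclideanLin B

/-- `W` is a `T`-module: a subspace of `V` stable under `T`. -/
def IsTModule (G : SimpleGraph X) (x : X) (W : Submodule ℂ (EuclideanSpace ℂ X)) : Prop :=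
  ∀ B ∈ subconstituentAlgebra G x, ∀ w ∈ W, act B w ∈ W

/-- `W` is an irreducible `T`-module. -/
def IsIrreducibleTModule (G : SimpleGraph X) (x : X)
    (W : Submodule ℂ (EuclideanSpace ℂ X)) : Prop :=
  IsTModule G x W ∧ W ≠ ⊥ ∧
    ∀ W' : Submodule ℂ (EuclideanSpace ℂ X), IsTModule G x W' → W' ≤ W → W' = ⊥ ∨ W' = W

/-- The subspace `E*_i W`. -/
noncomputable def dualPart (G : SimpleGraph X) (x : X) (i : ℕ)
    (W : Submodule ℂ (EuclideanSpace ℂ X)) : Submodule ℂ (EuclideanSpace ℂ X) :=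
  W.map (act (dualIdem G x i))

/-- `W` is thin: `dim E*_i W ≤ 1` for all `i`. -/
def IsThin (G : SimpleGraph X) (x : X) (W : Submodule ℂ (EuclideanSpace ℂ X)) : Prop :=
  ∀ i, Module.finrank ℂ (dualPart G x i W) ≤ 1

/-- The endpoint of `W`: the least `i` with `E*_i W ≠ 0`. -/
noncomputable def endpoint (G : SimpleGraph X) (x : X)
    (W : Submodule ℂ (EuclideanSpace ℂ X)) : ℕ :=
  sInf {i | dualPart G x i W ≠ ⊥}

/-- `η` is the local eigenvalue of `W`: the nonzero space `E*_2 W` consists of eigenvectors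
of `E*_2 A_2 E*_2` with eigenvalue `η`. -/
def IsLocalEigenvalue (G : SimpleGraph X) (x : X) (W : Submodule ℂ (EuclideanSpace ℂ X))
    (η : ℝ) : Prop :=
  dualPart G x 2 W ≠ ⊥ ∧
    ∀ w ∈ dualPart G x 2 W,
      act (dualIdem G x 2 * distMatrix G 2 * dualIdem G x 2) w = (η : ℂ) • w

/-- `ψ = b_2 (1 - b_3 / (1 + η))`, used for `η ≠ -1`. -/
noncomputable def psi (G : SimpleGraph X) (η : ℝ) : ℝ :=
  (b G 2 : ℝ) * (1 - (b G 3 : ℝ) / (1 + η))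

/-- `p_i(A)`. -/
noncomputable def pA (G : SimpleGraph X) (i : ℕ) : Matrix X X ℂ :=
  aeval (adj G) (p G i)

/-- The vector `E*_{i+2} A_i v`. -/
noncomputable def vec (G : SimpleGraph X) (x : X) (v : EuclideanSpace ℂ X) (i : ℕ) :
    EuclideanSpace ℂ X :=
  act (dualIdem G x (i + 2) * distMatrix G i) v

end DRG

/-! Parity and the triangle inequality confine the vectors `level G x v j i`, that is E*_j A_i v, to
j = i - 2, i, i + 2. Since the endpoint is 2, v has coordinate sum 0, so at each level j the three
vectors with i = j - 2, j, j + 2 add up to E*_j J v = 0, where J is the all-ones matrix. Thinness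
then leaves one unknown scalar per level, the ratio g_m with E*_{m+2} A_{m+4} v = g_m E*_{m+2} A_m
v; for m = 0 it is -(1 + η).

Reading A A_{i+1} = c_{i+2} A_{i+2} + b_i A_i level by level gives the raising coefficient c_{m+1}
(`step_up`), the lowering coefficient B_m = b_{m+2} + c_m g_{m-1} - c_{m+2} g_m (`step_mixed`), and
the recurrence g_{m+1} B_m = b_{m+4} g_m (`step_down`). Because A is Hermitian, B_m / c_{m+1} is
also the ratio of consecutive square norms. As long as no B_m vanishes, all E*_{m+2} A_m v are
nonzero, and they form an orthogonal basis (`ladder`, `linearIndependent_and_span_eq`).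

If η = -1 the solution is g = 0. Otherwise the three-term recurrence of the p_i solves it in terms
of the P_i(ψ) (`lowering_eq`, `ratio_succ_mul_lowering`), provided that no P_i(ψ) is zero. This is
where the bounds on η enter. The p_i are orthogonal on the spectrum for the weight k² - λ²
(`valency_sq_sub_mul_pA`), so P_i has no root outside [θ_d², θ_1²] (`eval_P_ne_zero`). Moreover b_2,
the root of P_2, lies strictly inside this interval (`b_two_mem_Ioo`), and hence the bounds on η say
exactly that ψ lies outside it (`psi_outside`).

The expansion in the p_h(A)v comes from p_i(A)v = E*_{i+2} A_i v - E*_i A_{i+2} v (`act_pA`),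
unrolled in steps of two. -/

namespace DRG

open Polynomial

/-! ### Distances and intersection numbers of a bipartite distance-regular graph. -/

section Combinatorics

set_option linter.unusedSectionVars false

variable {X : Type*} [Fintype X] {G : SimpleGraph X}

/-- A distance is even exactly when its ends have the same colour. Bipartiteness enters all later
arguments through this parity. -/
theorem even_dist_add_dist_add_dist (hc : G.Connected) (hb : G.IsBipartite) (x y z : X) :
    Even (G.dist x y + G.dist y z + G.dist x z) := by
  obtain ⟨col⟩ := hb
  let col' : G.Coloring Bool := G.recolorOfEquiv finTwoEquiv col
  have key : ∀ u w : X, Even (G.dist u w) ↔ (col' u ↔ col' w) := fun u w => by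
    obtain ⟨q, hq⟩ := hc.exists_walk_length_eq_dist u w
    rw [← hq]
    exact col'.even_length_iff_congr q
  rw [Nat.even_add, Nat.even_add, key, key, key]
  tauto

theorem exists_dist_eq (hc : G.Connected) {n : ℕ} (hn : n ≤ G.diam) :
    ∃ y z : X, G.dist y z = n := by
  have : Nonempty X := hc.nonempty
  obtain ⟨y, z, hyz⟩ := G.exists_dist_eq_diam
  induction h : G.diam - n generalizing n with
  | zero => exact ⟨y, z, by omega⟩
  | succ m ih =>
    obtain ⟨y, z, h1⟩ := ih (n := n + 1) (by omega) (by omega)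
    obtain ⟨w, hw⟩ := hc.exists_walk_length_eq_dist y z
    cases w with
    | nil => simp at h1
    | @cons _ w _ ha q =>
      refine ⟨w, z, ?_⟩
      have h2 := G.dist_le q
      have h3 := hc.dist_triangle (u := y) (v := w) (w := z)
      rw [SimpleGraph.dist_eq_one_iff_adj.2 ha] at h3
      rw [SimpleGraph.Walk.length_cons] at hw
      omega

theorem exists_dist_eq_one_and_dist_eq (hc : G.Connected) {n : ℕ} {y z : X}
    (h : G.dist y z = n + 1) : ∃ w, G.dist y w = 1 ∧ G.dist w z = n := by
  obtain ⟨w, hw⟩ := hc.exists_walk_length_eq_dist y z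
  cases w with
  | nil => simp at h
  | @cons _ w _ ha q =>
    have h1 := SimpleGraph.dist_eq_one_iff_adj.2 ha
    refine ⟨w, h1, ?_⟩
    have h2 := G.dist_le q
    have h3 := hc.dist_triangle (u := y) (v := w) (w := z)
    rw [SimpleGraph.Walk.length_cons] at hw
    omega

theorem dist_le_diam (hc : G.Connected) (y z : X) : G.dist y z ≤ G.diam := by
  have : Nonempty X := hc.nonempty
  refine SimpleGraph.dist_le_diam ?_
  rw [← SimpleGraph.connected_iff_ediam_ne_top]
  exact hc

theorem c_zero : c G 0 = 0 := by simp [c]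

theorem b_eq_zero (hc : G.Connected) {h : ℕ} (hh : G.diam ≤ h) : b G h = 0 := by
  rw [b, intersectionNumber, ← Nat.bot_eq_zero, Finset.sup_eq_bot_iff]
  intro q hq
  rw [sphereCount, Nat.bot_eq_zero, Finset.card_eq_zero, Finset.filter_eq_empty_iff]
  intro z _
  have := dist_le_diam hc z q.2
  omega

/-- The triangle inequality leaves distances i, i + 1, i + 2, and parity excludes the middle one;
hence there is no a_i term in the three-term relation for the A_i. -/
theorem sphereCount_one_eq (hG : IsDistanceRegular G) (hb : G.IsBipartite) (i : ℕ) (y z : X) :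
    sphereCount G 1 (i + 1) y z =
      (if G.dist y z = i + 2 then c G (i + 2) else 0) + (if G.dist y z = i then b G i else 0) := by
  rw [sphereCount_eq_intersectionNumber hG]
  by_cases h1 : G.dist y z = i + 2
  · simp [h1, c]
  by_cases h2 : G.dist y z = i
  · simp [h2, b]
  rw [if_neg h1, if_neg h2, ← sphereCount_eq_intersectionNumber hG, sphereCount,
    Finset.card_eq_zero, Finset.filter_eq_empty_iff]
  rintro w - ⟨h3, h4⟩
  have h5 := even_dist_add_dist_add_dist hG.1 hb y w z
  have h6 := hG.1.dist_triangle (u := y) (v := w) (w := z)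
  have h7 := hG.1.dist_triangle (u := w) (v := y) (w := z)
  rw [G.dist_comm (u := w) (v := y)] at h7
  have h8 : G.dist y z = i + 1 := by omega
  rw [h3, h4, h8] at h5
  grind

theorem c_pos (hG : IsDistanceRegular G) {i : ℕ} (h0 : i ≠ 0) (hi : i ≤ G.diam) : 0 < c G i := by
  obtain ⟨y, z, hyz⟩ := exists_dist_eq hG.1 hi
  obtain ⟨i, rfl⟩ := Nat.exists_eq_succ_of_ne_zero h0
  obtain ⟨w, h1, h2⟩ := exists_dist_eq_one_and_dist_eq hG.1 hyz
  rw [c, if_neg h0, ← hyz, ← sphereCount_eq_intersectionNumber hG, sphereCount, Finset.card_pos]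
  refine ⟨w, ?_⟩
  simp [h1, h2, hyz]

theorem b_pos (hG : IsDistanceRegular G) {i : ℕ} (hi : i < G.diam) : 0 < b G i := by
  obtain ⟨y, z, hyz⟩ := exists_dist_eq hG.1 (show i + 1 ≤ G.diam from hi)
  obtain ⟨w, h1, h2⟩ := exists_dist_eq_one_and_dist_eq hG.1 hyz
  rw [b, ← h2, ← sphereCount_eq_intersectionNumber hG, sphereCount, Finset.card_pos]
  refine ⟨y, ?_⟩
  rw [G.dist_comm] at h1
  simp [h1, h2, hyz]

theorem card_dist_eq_one (hG : IsDistanceRegular G) (y : X) :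
    (Finset.univ.filter fun z => G.dist y z = 1).card = valency G := by
  rw [valency, b, ← G.dist_self (v := y), ← sphereCount_eq_intersectionNumber hG, sphereCount]
  congr 1
  ext z
  simp [G.dist_comm (u := z) (v := y)]

theorem c_add_b (hG : IsDistanceRegular G) (hb : G.IsBipartite) {i : ℕ} (hi : i ≤ G.diam) :
    c G i + b G i = valency G := by
  classical
  rcases Nat.eq_zero_or_pos i with rfl | h0
  · simp [c, valency]
  obtain ⟨y, z, hyz⟩ := exists_dist_eq hG.1 hi
  rw [← card_dist_eq_one hG y, c, if_neg h0.ne', b, ← hyz,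
    ← sphereCount_eq_intersectionNumber hG, ← sphereCount_eq_intersectionNumber hG, sphereCount,
    sphereCount, ← Finset.card_union_of_disjoint]
  · congr 1
    ext w
    simp only [Finset.mem_union, Finset.mem_filter, Finset.mem_univ, true_and]
    constructor
    · tauto
    · intro h1
      have h5 := even_dist_add_dist_add_dist hG.1 hb y w z
      have h6 := hG.1.dist_triangle (u := y) (v := w) (w := z)
      have h7 := hG.1.dist_triangle (u := w) (v := y) (w := z)
      rw [G.dist_comm (u := w) (v := y)] at h7
      grind
  · rw [Finset.disjoint_filter]
    grind

theorem c_one (hG : IsDistanceRegular G) (hD : 1 ≤ G.diam) : c G 1 = 1 := by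
  obtain ⟨y, z, hyz⟩ := exists_dist_eq hG.1 hD
  have h1 := sphereCount_eq_intersectionNumber hG 1 0 y z
  rw [hyz] at h1
  rw [c, if_neg one_ne_zero, Nat.sub_self, ← h1, sphereCount, Finset.card_eq_one]
  refine ⟨z, ?_⟩
  ext w
  simp only [Finset.mem_filter, Finset.mem_univ, true_and, Finset.mem_singleton]
  rw [hG.1.dist_eq_zero_iff]
  constructor
  · exact fun h => h.2
  · rintro rfl
    exact ⟨hyz, rfl⟩

variable [DecidableEq X]

theorem distMatrix_zero (hc : G.Connected) : distMatrix G 0 = 1 := by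
  ext y z
  simp [distMatrix, Matrix.one_apply, hc.dist_eq_zero_iff]

theorem distMatrix_eq_zero (hc : G.Connected) {i : ℕ} (hi : G.diam < i) : distMatrix G i = 0 := by
  ext y z
  have := dist_le_diam hc y z
  simp [distMatrix]
  omega

theorem adj_mul_distMatrix_succ (hG : IsDistanceRegular G) (hb : G.IsBipartite) (i : ℕ) :
    adj G * distMatrix G (i + 1) =
      (c G (i + 2) : ℝ) • distMatrix G (i + 2) + (b G i : ℝ) • distMatrix G i := by
  ext y z
  have h1 : (adj G * distMatrix G (i + 1)) y z = (sphereCount G 1 (i + 1) y z : ℂ) := by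
    simp only [Matrix.mul_apply, adj, distMatrix, sphereCount, Matrix.of_apply, mul_ite, mul_one,
      mul_zero, ← ite_and, Finset.sum_boole, and_comm]
  rw [h1, sphereCount_one_eq hG hb]
  simp [distMatrix]

theorem aeval_f (hG : IsDistanceRegular G) (hb : G.IsBipartite) (hD : 1 ≤ G.diam) :
    ∀ i, aeval (adj G) (f G i) = distMatrix G i
  | 0 => by simp [f, distMatrix_zero hG.1]
  | 1 => by simp [f, c_one hG hD, adj]
  | i + 2 => by
    rw [f, map_mul, map_sub, map_mul, map_mul, aeval_f hG hb hD i, aeval_f hG hb hD (i + 1),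
      aeval_X, aeval_C, aeval_C, adj_mul_distMatrix_succ hG hb, ← Algebra.smul_def,
      ← Algebra.smul_def, add_sub_cancel_right, smul_smul]
    by_cases h : i + 2 ≤ G.diam
    · rw [inv_mul_cancel₀, one_smul]
      exact_mod_cast (c_pos hG (by omega) h).ne'
    -- Beyond the diameter both sides are 0, whatever the value of the inverse.
    · simp [distMatrix_eq_zero hG.1 (lt_of_not_ge h)]

theorem kk_eq (hG : IsDistanceRegular G) (i : ℕ) (y : X) :
    kk G i = (Finset.univ.filter fun z => G.dist y z = i).card := by
  rw [kk, ← G.dist_self (v := y), ← sphereCount_eq_intersectionNumber hG, sphereCount]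
  congr 1
  ext z
  simp [G.dist_comm (u := z) (v := y)]

theorem kk_zero (hG : IsDistanceRegular G) : kk G 0 = 1 := by
  obtain ⟨y⟩ := hG.1.nonempty
  rw [kk_eq hG 0 y, Finset.card_eq_one]
  refine ⟨y, ?_⟩
  ext z
  simp [hG.1.dist_eq_zero_iff, eq_comm]

theorem kk_one (hG : IsDistanceRegular G) : kk G 1 = valency G := by
  obtain ⟨y⟩ := hG.1.nonempty
  rw [kk_eq hG 1 y, card_dist_eq_one hG]

theorem kk_eq_zero (hG : IsDistanceRegular G) {i : ℕ} (hi : G.diam < i) : kk G i = 0 := by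
  obtain ⟨y⟩ := hG.1.nonempty
  rw [kk_eq hG i y, Finset.card_eq_zero, Finset.filter_eq_empty_iff]
  intro z _
  have := dist_le_diam hG.1 y z
  omega

theorem distMatrix_mulVec_one (hG : IsDistanceRegular G) (i : ℕ) :
    (distMatrix G i).mulVec 1 = fun _ => (kk G i : ℂ) := by
  ext y
  simp [kk_eq hG i y, Matrix.mulVec, dotProduct, distMatrix, Finset.sum_boole]

/-- Row sums of A A_{i+1} = c_{i+2} A_{i+2} + b_i A_i. With k = c_{i+1} + b_{i+1} this yields k_i
b_i = k_{i+1} c_{i+1} by induction. -/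
theorem valency_mul_kk (hG : IsDistanceRegular G) (hb : G.IsBipartite) (i : ℕ) :
    valency G * kk G (i + 1) = c G (i + 2) * kk G (i + 2) + b G i * kk G i := by
  obtain ⟨y⟩ := hG.1.nonempty
  have h := congrArg (fun M => M.mulVec (1 : X → ℂ) y) (adj_mul_distMatrix_succ hG hb i)
  simp only [← Matrix.mulVec_mulVec, Matrix.add_mulVec, Matrix.smul_mulVec,
    distMatrix_mulVec_one hG] at h
  have h2 : (fun _ => (kk G (i + 1) : ℂ) : X → ℂ) = (kk G (i + 1) : ℂ) • 1 := by
    ext; simp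
  rw [h2, Matrix.mulVec_smul, adj, distMatrix_mulVec_one hG, kk_one hG] at h
  simp only [Pi.smul_apply, Pi.add_apply, smul_eq_mul, Complex.real_smul,
    Complex.ofReal_natCast] at h
  rw [mul_comm]
  exact_mod_cast h

/-- `k_i b_i = k_{i+1} c_{i+1}`. -/
theorem kk_mul_b (hG : IsDistanceRegular G) (hb : G.IsBipartite) (hD : 1 ≤ G.diam) :
    ∀ i, kk G i * b G i = kk G (i + 1) * c G (i + 1)
  | 0 => by rw [kk_zero hG, kk_one hG, c_one hG hD, valency, one_mul, mul_one]
  | i + 1 => by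
    by_cases hi : i + 1 ≤ G.diam
    · have h1 := kk_mul_b hG hb hD i
      have h2 := valency_mul_kk hG hb i
      have h3 := c_add_b hG hb hi
      rw [← h3] at h2
      nlinarith
    · rw [kk_eq_zero hG (lt_of_not_ge hi), kk_eq_zero hG (i := i + 1 + 1) (by omega)]
      simp

theorem kk_pos (hG : IsDistanceRegular G) {i : ℕ} (hi : i ≤ G.diam) : 0 < kk G i := by
  obtain ⟨y, z, h⟩ := exists_dist_eq hG.1 hi
  rw [kk_eq hG i y, Finset.card_pos]
  exact ⟨z, by simp [h]⟩

end Combinatorics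

/-! ### Real polynomials in a Hermitian matrix. -/

section Spectral

variable {n : Type*} [Fintype n] [DecidableEq n] {M : Matrix n n ℂ}

theorem _root_.Matrix.IsHermitian.aeval_eq_conj (hM : M.IsHermitian) (q : ℝ[X]) :
    aeval M q = (hM.eigenvectorUnitary : Matrix n n ℂ) *
      Matrix.diagonal (fun i => ((q.eval (hM.eigenvalues i) : ℝ) : ℂ)) *
        star (hM.eigenvectorUnitary : Matrix n n ℂ) := by
  have h1 : M = Unitary.conjStarAlgAut ℝ _ hM.eigenvectorUnitary
      (Matrix.diagonal (fun i => (hM.eigenvalues i : ℂ))) := by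
    conv_lhs => rw [hM.spectral_theorem]
    rfl
  have h2 : aeval (Matrix.diagonal (fun i => (hM.eigenvalues i : ℂ))) q =
      Matrix.diagonal (fun i => ((q.eval (hM.eigenvalues i) : ℝ) : ℂ)) := by
    have h3 := aeval_algHom_apply (Matrix.diagonalAlgHom (n := n) (α := ℂ) ℝ)
      (fun i => (hM.eigenvalues i : ℂ)) q
    simp only [Matrix.diagonalAlgHom_apply] at h3
    rw [h3]
    congr 1
    ext i
    have h4 := aeval_algHom_apply (Pi.evalAlgHom ℝ (fun _ : n => ℂ) i)
      (fun i => (hM.eigenvalues i : ℂ)) q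
    simp only [Pi.evalAlgHom_apply] at h4
    rw [← h4, ← Complex.coe_algebraMap, aeval_algebraMap_apply, coe_aeval_eq_eval]
  conv_lhs => rw [h1]
  have h5 := aeval_algHom_apply
    ((Unitary.conjStarAlgAut ℝ _ hM.eigenvectorUnitary).toAlgEquiv : Matrix n n ℂ →ₐ[ℝ] Matrix n n ℂ)
    (Matrix.diagonal (fun i => (hM.eigenvalues i : ℂ))) q
  rw [h2] at h5
  exact h5

theorem _root_.Matrix.IsHermitian.trace_aeval (hM : M.IsHermitian) (q : ℝ[X]) :
    (aeval M q).trace = ((∑ i, q.eval (hM.eigenvalues i) : ℝ) : ℂ) := by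
  rw [hM.aeval_eq_conj, Matrix.trace_mul_comm, ← mul_assoc, Unitary.coe_star_mul_self, one_mul,
    Matrix.trace_diagonal]
  simp

theorem _root_.Matrix.IsHermitian.aeval_eq_zero_iff (hM : M.IsHermitian) (q : ℝ[X]) :
    aeval M q = 0 ↔ ∀ t ∈ spectrum ℝ M, q.eval t = 0 := by
  rw [hM.spectrum_real_eq_range_eigenvalues, Set.forall_mem_range]
  constructor
  · intro h i
    have h1 : star (hM.eigenvectorUnitary : Matrix n n ℂ) * aeval M q *
        (hM.eigenvectorUnitary : Matrix n n ℂ) = 0 := by rw [h]; simp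
    rw [hM.aeval_eq_conj, ← mul_assoc, ← mul_assoc, Unitary.coe_star_mul_self, one_mul, mul_assoc,
      Unitary.coe_star_mul_self, mul_one] at h1
    simpa using congrFun (congrFun h1 i) i
  · intro h
    rw [hM.aeval_eq_conj]
    simp [h]

/-- If a polynomial is nonnegative on the spectrum and its trace vanishes, then it vanishes on the
spectrum. -/
theorem _root_.Matrix.IsHermitian.eval_eq_zero_of_trace_aeval_eq_zero (hM : M.IsHermitian)
    {q : ℝ[X]} (h0 : ∀ t ∈ spectrum ℝ M, 0 ≤ q.eval t) (h : (aeval M q).trace = 0) :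
    ∀ t ∈ spectrum ℝ M, q.eval t = 0 := by
  rw [hM.spectrum_real_eq_range_eigenvalues, Set.forall_mem_range] at h0 ⊢
  rw [hM.trace_aeval, Complex.ofReal_eq_zero,
    Finset.sum_eq_zero_iff_of_nonneg (fun i _ => h0 i)] at h
  exact fun i => h i (Finset.mem_univ i)

end Spectral

/-! ### Recurrences and orthogonality of the polynomials p_i and P_i. -/

section Polynomials

set_option linter.unusedSectionVars false

variable {X : Type*} [Fintype X] {G : SimpleGraph X}

theorem X_mul_f (hG : IsDistanceRegular G) {i : ℕ} (hi : i + 2 ≤ G.diam) :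
    Polynomial.X * f G (i + 1) = C (c G (i + 2) : ℝ) * f G (i + 2) + C (b G i : ℝ) * f G i := by
  rw [f, ← mul_assoc, ← C_mul, mul_inv_cancel₀, C_1, one_mul, sub_add_cancel]
  exact_mod_cast (c_pos hG (by omega) hi).ne'

theorem p_zero : p G 0 = 1 := by simp [p, f]

theorem p_one : p G 1 = f G 1 := by simp [p, Finset.sum_filter, Finset.sum_range_succ]

theorem sum_filter_even_succ_succ {M : Type*} [AddCommMonoid M] (g : ℕ → M) (i : ℕ) :
    ∑ h ∈ (Finset.range (i + 2 + 1)).filter (fun h => Even (i + 2 - h)), g h =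
      ∑ h ∈ (Finset.range (i + 1)).filter (fun h => Even (i - h)), g h + g (i + 2) := by
  rw [Finset.sum_filter, Finset.sum_filter, Finset.sum_range_succ, Finset.sum_range_succ]
  rw [if_neg (show ¬ Even (i + 2 - (i + 1)) by simp [show i + 2 - (i + 1) = 1 by omega])]
  simp only [Nat.sub_self, Even.zero, if_true, add_zero]
  congr 1
  refine Finset.sum_congr rfl fun h hh => ?_
  rw [Finset.mem_range] at hh
  have : Even (i + 2 - h) ↔ Even (i - h) := by
    rw [show i + 2 - h = i - h + 2 by omega, Nat.even_add]
    simp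
  simp only [this]

theorem p_add_two (i : ℕ) : p G (i + 2) = p G i + f G (i + 2) := by
  rw [p, p, sum_filter_even_succ_succ]

theorem f_one (hG : IsDistanceRegular G) (hD : 1 ≤ G.diam) : f G 1 = Polynomial.X := by
  simp [f, c_one hG hD]

theorem b_eq_sub (hG : IsDistanceRegular G) (hb : G.IsBipartite) {i : ℕ} (hi : i ≤ G.diam) :
    (b G i : ℝ) = valency G - c G i := by
  have := c_add_b hG hb hi
  rw [← this]
  push_cast
  ring

/-- Summing the recurrences of the f_h, each f_j with j ≤ i of the right parity gets the coefficient
c_j + b_j = k. So λ p_{i+1} = c_{i+2} f_{i+2} + k p_i, and k = c_{i+2} + b_{i+2}. -/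
theorem X_mul_p (hG : IsDistanceRegular G) (hb : G.IsBipartite) :
    ∀ {i : ℕ}, i + 2 ≤ G.diam →
      Polynomial.X * p G (i + 1) = C (c G (i + 2) : ℝ) * p G (i + 2) + C (b G (i + 2) : ℝ) * p G i
  | 0, hi => by
    have h1 := X_mul_f hG (i := 0) hi
    rw [p_one, h1, p_add_two, p_zero, b_eq_sub hG hb hi, f, valency]
    simp
    ring
  | 1, hi => by
    have h1 := X_mul_f hG (i := 1) hi
    rw [p_add_two, mul_add, h1, p_zero, p_add_two, p_one, b_eq_sub hG hb hi,
      b_eq_sub hG hb (i := 1) (by omega), c_one hG (by omega), f_one hG (by omega)]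
    simp
    ring
  | i + 2, hi => by
    have h1 := X_mul_f hG (i := i + 2) hi
    have h2 := X_mul_p hG hb (i := i) (by omega)
    rw [p_add_two, mul_add, h2, h1, p_add_two (i + 2), p_add_two i, b_eq_sub hG hb hi,
      b_eq_sub hG hb (i := i + 2) (by omega)]
    simp
    ring

theorem P_zero : P G 0 = 1 := by
  ext m
  rw [P, if_pos Even.zero, p_zero, coeff_contract two_ne_zero, coeff_one, coeff_one]
  simp

theorem P_one (hG : IsDistanceRegular G) (hD : 1 ≤ G.diam) : P G 1 = 1 := by
  have h1 : ¬ Even 1 := by decide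
  ext m
  rw [P, if_neg h1, p_one, f_one hG hD, coeff_contract two_ne_zero, coeff_divX, coeff_X, coeff_one]
  simp [eq_comm]

theorem comp_X_sq_injective : Function.Injective fun q : ℝ[X] => q.comp (Polynomial.X ^ 2) := by
  simp_rw [← expand_eq_comp_X_pow]
  exact expand_injective two_pos

/-- The recurrence of the p_i with λ² as the variable: for even i a factor λ² survives on the left,
for odd i a common factor λ cancels. -/
theorem parity_mul_P (hG : IsDistanceRegular G) (hb : G.IsBipartite) {i : ℕ}
    (hi : i + 2 ≤ G.diam) :
    (if Even i then Polynomial.X else 1) * P G (i + 1) =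
      C (c G (i + 2) : ℝ) * P G (i + 2) + C (b G (i + 2) : ℝ) * P G i := by
  have h := X_mul_p hG hb hi
  apply comp_X_sq_injective
  rw [p_eq G i, p_eq G (i + 1), p_eq G (i + 2)] at h
  by_cases he : Even i
  · have h1 : ¬ Even (i + 1) := by grind
    have h2 : Even (i + 2) := by grind
    simp only [he, h1, h2, if_true, if_false] at h ⊢
    simp only [mul_comp, add_comp, C_comp, X_comp, ← h]
    ring
  · have h1 : Even (i + 1) := by grind
    have h2 : ¬ Even (i + 2) := by grind
    simp only [he, h1, h2, if_true, if_false] at h ⊢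
    simp only [mul_comp, add_comp, C_comp, one_mul]
    apply mul_left_cancel₀ (X_ne_zero (R := ℝ))
    rw [h]
    ring

/-- This exhibits b_2 as the root of P_2, which later locates b_2 among the squared eigenvalues. -/
theorem c_mul_P_two (hG : IsDistanceRegular G) (hb : G.IsBipartite) (hD : 2 ≤ G.diam) :
    C (c G 2 : ℝ) * P G 2 = Polynomial.X - C (b G 2 : ℝ) := by
  have h := parity_mul_P hG hb (i := 0) hD
  rw [P_zero, P_one hG (by omega)] at h
  simp only [Even.zero, if_true, zero_add, mul_one] at h
  rw [h]
  ring

variable [DecidableEq X]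

/-- Each (k² - A²) A_h is a combination of A_{h-2}, A_h, A_{h+2}, and the sum over h telescopes.
Only A_i and A_{i+2} remain, so (k² - A²) p_i(A) is trace-orthogonal to every polynomial in A of
degree below i. -/
theorem valency_sq_sub_mul_pA (hG : IsDistanceRegular G) (hb : G.IsBipartite) (hD : 2 ≤ G.diam) :
    ∀ {i : ℕ}, i ≤ G.diam →
      aeval (adj G) ((C (valency G : ℝ) ^ 2 - Polynomial.X ^ 2) * p G i) =
        ((b G i : ℝ) * b G (i + 1)) • distMatrix G i -
          ((c G (i + 1) : ℝ) * c G (i + 2)) • distMatrix G (i + 2)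
  | 0, _ => by
    have h1 := adj_mul_distMatrix_succ hG hb 0
    rw [p_zero, mul_one, map_sub, map_pow, map_pow, aeval_X, aeval_C, pow_two (adj G)]
    rw [zero_add, ← adj, distMatrix_zero hG.1] at h1
    rw [h1, b_eq_sub hG hb (i := 1) (by omega), c_one hG (by omega), distMatrix_zero hG.1,
      valency, ← map_pow, Algebra.algebraMap_eq_smul_one]
    module
  | 1, _ => by
    have h1 := adj_mul_distMatrix_succ hG hb 0
    have h2 := adj_mul_distMatrix_succ hG hb 1
    rw [zero_add, ← adj, distMatrix_zero hG.1] at h1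
    rw [← adj] at h2
    rw [p_one, f_one hG (by omega), map_mul, map_sub, map_pow, map_pow, aeval_X, aeval_C, sub_mul,
      pow_two (adj G), mul_assoc, h1, ← map_pow, Algebra.algebraMap_eq_smul_one, mul_add,
      Algebra.mul_smul_comm, h2, Algebra.mul_smul_comm, Algebra.smul_mul_assoc, one_mul, mul_one,
      b_eq_sub hG hb (i := 2) (by omega), b_eq_sub hG hb (i := 1) (by omega),
      c_one hG (by omega), valency]
    change _ = _ • adj G - _
    module
  | i + 2, hi => by
    have h0 := valency_sq_sub_mul_pA hG hb hD (i := i) (by omega)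
    have h1 := adj_mul_distMatrix_succ hG hb i
    have h2 := adj_mul_distMatrix_succ hG hb (i + 1)
    have h3 := adj_mul_distMatrix_succ hG hb (i + 2)
    -- The identity b = k - c holds only up to index D; at i + 2 = D the factor b_D = 0 makes up for
    -- it.
    have h4 : ((b G (i + 2) : ℝ) * b G (i + 2 + 1)) =
        b G (i + 2) * (valency G - c G (i + 3)) := by
      rcases Nat.lt_or_ge (i + 2) G.diam with h | h
      · rw [b_eq_sub hG hb (i := i + 2 + 1) h]
      · rw [b_eq_zero hG.1 h]; simp
    rw [p_add_two, mul_add, map_add, h0, map_mul, aeval_f hG hb (by omega), map_sub, map_pow,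
      map_pow, aeval_X, aeval_C, sub_mul, pow_two (adj G), mul_assoc, h2, mul_add,
      Algebra.mul_smul_comm, Algebra.mul_smul_comm, h1, h3, ← map_pow,
      Algebra.algebraMap_eq_smul_one, Algebra.smul_mul_assoc, one_mul, h4,
      b_eq_sub hG hb (i := i + 2) hi, b_eq_sub hG hb (i := i + 1) (by omega)]
    module

theorem adj_eq_adjMatrix [DecidableRel G.Adj] : adj G = G.adjMatrix ℂ := by
  ext y z
  simp [adj, distMatrix, SimpleGraph.dist_eq_one_iff_adj, SimpleGraph.adjMatrix_apply]

theorem adj_pow_apply_eq_zero {m : ℕ} {y z : X} (h : m < G.dist y z) : (adj G ^ m) y z = 0 := by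
  classical
  rw [adj_eq_adjMatrix, SimpleGraph.adjMatrix_pow_apply_eq_card_walk, Nat.cast_eq_zero,
    Fintype.card_eq_zero_iff]
  refine ⟨fun w => ?_⟩
  have h1 := G.dist_le w.1
  have h2 : w.1.length = m := w.2
  omega

theorem adj_pow_apply_ne_zero (hc : G.Connected) (y z : X) : (adj G ^ G.dist y z) y z ≠ 0 := by
  classical
  rw [adj_eq_adjMatrix, SimpleGraph.adjMatrix_pow_apply_eq_card_walk, Nat.cast_ne_zero]
  obtain ⟨w, hw⟩ := hc.exists_walk_length_eq_dist y z
  have : Nonempty {w : G.Walk y z | w.length = G.dist y z} := ⟨⟨w, hw⟩⟩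
  exact Fintype.card_ne_zero

theorem aeval_adj_apply (q : ℝ[X]) (y z : X) :
    aeval (adj G) q y z = ∑ i ∈ Finset.range (q.natDegree + 1), q.coeff i • (adj G ^ i) y z := by
  rw [aeval_eq_sum_range, Matrix.sum_apply]
  simp [Matrix.smul_apply]

theorem aeval_adj_apply_eq_zero {q : ℝ[X]} {y z : X} (h : q.natDegree < G.dist y z) :
    aeval (adj G) q y z = 0 := by
  rw [aeval_adj_apply]
  refine Finset.sum_eq_zero fun i hi => ?_
  rw [Finset.mem_range] at hi
  rw [adj_pow_apply_eq_zero (by omega), smul_zero]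

/-- At a pair of vertices whose distance is the degree of q, only the leading term has a nonzero
entry. -/
theorem aeval_adj_ne_zero (hc : G.Connected) {q : ℝ[X]} (hq : q ≠ 0) (h : q.natDegree ≤ G.diam) :
    aeval (adj G) q ≠ 0 := by
  obtain ⟨y, z, hyz⟩ := exists_dist_eq hc h
  intro h0
  have h1 : aeval (adj G) q y z = 0 := by rw [h0]; rfl
  rw [aeval_adj_apply, Finset.sum_range_succ, Finset.sum_eq_zero, zero_add, ← hyz] at h1
  · rcases smul_eq_zero.1 h1 with h2 | h2
    · rw [hyz, coeff_natDegree, leadingCoeff_eq_zero] at h2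
      exact hq h2
    · exact adj_pow_apply_ne_zero hc y z h2
  · intro i hi
    rw [Finset.mem_range] at hi
    rw [adj_pow_apply_eq_zero (by omega), smul_zero]

/-- A polynomial in A of degree below i has zero entries at pairs at distance i, the only places
where A_i is nonzero. -/
theorem trace_distMatrix_mul_aeval {i : ℕ} {q : ℝ[X]} (h : q.natDegree < i) :
    (distMatrix G i * aeval (adj G) q).trace = 0 := by
  refine Finset.sum_eq_zero fun y _ => ?_
  rw [Matrix.diag_apply, Matrix.mul_apply]
  refine Finset.sum_eq_zero fun z _ => ?_
  by_cases hz : G.dist y z = i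
  · rw [aeval_adj_apply_eq_zero, mul_zero]
    rw [G.dist_comm, hz]
    exact h
  · simp [distMatrix, hz]

theorem distMatrix_isHermitian (i : ℕ) : (distMatrix G i).IsHermitian := by
  ext y z
  simp [distMatrix, G.dist_comm (u := z) (v := y), apply_ite]

end Polynomials

/-! ### The eigenvalues, the roots of P_i, and the position of ψ. -/

section Eigenvalues

set_option linter.unusedSectionVars false

variable {X : Type*} [Fintype X] {G : SimpleGraph X}

theorem natDegree_f_le : ∀ i, (f G i).natDegree ≤ i
  | 0 => by simp [f]
  | 1 => by
    rw [f]
    exact (natDegree_C_mul_le _ _).trans natDegree_X_le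
  | i + 2 => by
    rw [f]
    refine (natDegree_C_mul_le _ _).trans ((natDegree_sub_le _ _).trans (max_le ?_ ?_))
    · refine natDegree_mul_le.trans ?_
      have := natDegree_f_le (i + 1)
      have := natDegree_X_le (R := ℝ)
      omega
    · refine (natDegree_C_mul_le _ _).trans ?_
      have := natDegree_f_le i
      omega

theorem coeff_f_self_ne_zero (hG : IsDistanceRegular G) :
    ∀ {i}, i ≤ G.diam → (f G i).coeff i ≠ 0
  | 0, _ => by simp [f]
  | 1, hi => by simp [f, c_one hG hi]
  | i + 2, hi => by
    have h1 : (f G i).coeff (i + 2) = 0 :=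
      coeff_eq_zero_of_natDegree_lt (by have := natDegree_f_le (G := G) i; omega)
    rw [f, coeff_C_mul, coeff_sub, coeff_C_mul, coeff_X_mul, h1, mul_zero, sub_zero]
    refine mul_ne_zero (inv_ne_zero ?_) (coeff_f_self_ne_zero hG (by omega))
    exact_mod_cast (c_pos hG (by omega) hi).ne'

theorem natDegree_p_le (i : ℕ) : (p G i).natDegree ≤ i := by
  refine natDegree_sum_le_of_forall_le _ _ fun h hh => ?_
  have := natDegree_f_le (G := G) h
  simp only [Finset.mem_filter, Finset.mem_range] at hh
  omega

theorem coeff_p_self (i : ℕ) : (p G i).coeff i = (f G i).coeff i := by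
  rw [p, finsetSum_coeff]
  refine (Finset.sum_eq_single i (fun h hh hne => ?_) fun h => ?_)
  · refine coeff_eq_zero_of_natDegree_lt ?_
    have := natDegree_f_le (G := G) h
    simp only [Finset.mem_filter, Finset.mem_range] at hh
    omega
  · simp at h

theorem p_ne_zero (hG : IsDistanceRegular G) {i : ℕ} (hi : i ≤ G.diam) : p G i ≠ 0 := by
  intro h
  have := coeff_f_self_ne_zero hG hi
  rw [← coeff_p_self, h, coeff_zero] at this
  exact this rfl

theorem exists_p_eq_mul_of_eval_P_eq_zero {i : ℕ} {s : ℝ} (h : (P G i).eval s = 0) :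
    ∃ q : ℝ[X], p G i = (Polynomial.X ^ 2 - C s) * q := by
  obtain ⟨r, hr⟩ := dvd_iff_isRoot.2 h
  rw [p_eq, hr]
  split_ifs
  · exact ⟨r.comp (Polynomial.X ^ 2), by simp⟩
  · exact ⟨Polynomial.X * r.comp (Polynomial.X ^ 2), by simp; ring⟩

variable [DecidableEq X]

theorem adj_isHermitian : (adj G).IsHermitian := distMatrix_isHermitian 1

theorem hasEigenvalue_of_mem_spectrum {t : ℝ} (ht : t ∈ spectrum ℝ (adj G)) :
    Module.End.HasEigenvalue (Matrix.toLin' (adj G)) (t : ℂ) := by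
  rw [Module.End.hasEigenvalue_iff_mem_spectrum, Matrix.spectrum_toLin']
  exact (spectrum.algebraMap_mem_iff ℂ).2 ht

theorem mem_spectrum_of_mulVec_eq {t : ℝ} {w : X → ℂ} (hw : w ≠ 0)
    (h : (adj G).mulVec w = (t : ℂ) • w) : t ∈ spectrum ℝ (adj G) := by
  apply (spectrum.algebraMap_mem_iff ℂ).1
  rw [← Matrix.spectrum_toLin', ← Module.End.hasEigenvalue_iff_mem_spectrum]
  refine Module.End.hasEigenvalue_of_hasEigenvector (x := w) ⟨?_, hw⟩
  rw [Module.End.mem_eigenspace_iff, Matrix.toLin'_apply]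
  exact h

/-- Gershgorin's theorem: the diagonal of A is zero and each row sum is k. -/
theorem abs_le_valency (hG : IsDistanceRegular G) {t : ℝ} (ht : t ∈ spectrum ℝ (adj G)) :
    |t| ≤ valency G := by
  obtain ⟨y, hy⟩ := eigenvalue_mem_ball (hasEigenvalue_of_mem_spectrum ht)
  have h1 : adj G y y = 0 := by simp [adj, distMatrix]
  rw [h1, mem_closedBall_zero_iff, Complex.norm_real, Real.norm_eq_abs] at hy
  refine hy.trans ?_
  rw [← card_dist_eq_one hG y, ← Finset.sum_boole]
  refine (Finset.sum_le_univ_sum_of_nonneg fun _ => norm_nonneg _).trans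
    (Finset.sum_le_sum fun z _ => ?_)
  simp only [adj, distMatrix, Matrix.of_apply]
  split_ifs <;> simp

theorem valency_mem_spectrum (hG : IsDistanceRegular G) :
    (valency G : ℝ) ∈ spectrum ℝ (adj G) := by
  have : Nonempty X := hG.1.nonempty
  refine mem_spectrum_of_mulVec_eq (w := 1) one_ne_zero ?_
  rw [adj, distMatrix_mulVec_one hG, kk_one hG]
  ext
  simp

/-- Changing the sign of an eigenvector on one colour class negates the eigenvalue. -/
theorem neg_mem_spectrum (hG : IsDistanceRegular G) (hb : G.IsBipartite) {t : ℝ}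
    (ht : t ∈ spectrum ℝ (adj G)) : -t ∈ spectrum ℝ (adj G) := by
  obtain ⟨x⟩ := hG.1.nonempty
  obtain ⟨w, hw, hw0⟩ := (hasEigenvalue_of_mem_spectrum ht).exists_hasEigenvector
  rw [Module.End.mem_eigenspace_iff, Matrix.toLin'_apply] at hw
  refine mem_spectrum_of_mulVec_eq (w := fun y => (-1) ^ G.dist x y * w y) ?_ ?_
  · intro h
    apply hw0
    ext y
    simpa using congrFun h y
  · ext y
    have h1 := congrFun hw y
    simp only [Matrix.mulVec, dotProduct, Pi.smul_apply, smul_eq_mul] at h1 ⊢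
    have h2 : ∀ z, adj G y z * ((-1) ^ G.dist x z * w z) =
        -(-1) ^ G.dist x y * (adj G y z * w z) := by
      intro z
      by_cases hz : G.dist y z = 1
      · have h3 := even_dist_add_dist_add_dist hG.1 hb x y z
        have h4 : (-1 : ℂ) ^ G.dist x z = -(-1) ^ G.dist x y := by
          rw [hz] at h3
          rcases Nat.even_or_odd (G.dist x y) with h5 | h5
          · rw [h5.neg_one_pow, Odd.neg_one_pow (by grind)]
          · rw [h5.neg_one_pow, Even.neg_one_pow (by grind), neg_neg]
        rw [h4]
        ring
      · simp [adj, distMatrix, hz]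
    simp_rw [h2]
    rw [← Finset.mul_sum, h1]
    push_cast
    ring

/-- The finite set of eigenvalues of `A`. -/
noncomputable def eigenvalueFinset (G : SimpleGraph X) : Finset ℝ :=
  (adj G).finite_real_spectrum.toFinset

theorem mem_eigenvalueFinset {t : ℝ} : t ∈ eigenvalueFinset G ↔ t ∈ spectrum ℝ (adj G) := by
  simp [eigenvalueFinset]

theorem aeval_eq_zero_iff {q : ℝ[X]} :
    aeval (adj G) q = 0 ↔ ∀ t ∈ eigenvalueFinset G, q.eval t = 0 := by
  simp_rw [mem_eigenvalueFinset]
  exact adj_isHermitian.aeval_eq_zero_iff q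

/-- At most D + 1, since λ f_D - b_{D-1} f_{D-1} has degree D + 1 and annihilates A; at least D + 1,
since no nonzero polynomial of degree at most D does. Consequently `theta` never takes its default
value at indices up to D. -/
theorem card_eigenvalueFinset (hG : IsDistanceRegular G) (hb : G.IsBipartite) (hD : 1 ≤ G.diam) :
    (eigenvalueFinset G).card = G.diam + 1 := by
  apply le_antisymm
  · obtain ⟨m, hm⟩ : ∃ m, G.diam = m + 1 := ⟨G.diam - 1, by omega⟩
    set F : ℝ[X] := Polynomial.X * f G (m + 1) - C (b G m : ℝ) * f G m with hF
    have h1 : aeval (adj G) F = 0 := by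
      rw [hF, map_sub, map_mul, map_mul, aeval_f hG hb hD, aeval_f hG hb hD, aeval_X, aeval_C,
        adj_mul_distMatrix_succ hG hb, distMatrix_eq_zero hG.1 (i := m + 2) (by omega),
        smul_zero, zero_add, ← Algebra.smul_def, sub_self]
    have h2 : F.coeff (m + 2) ≠ 0 := by
      rw [hF, coeff_sub, coeff_X_mul, coeff_C_mul, coeff_eq_zero_of_natDegree_lt (p := f G m)
        (by have := natDegree_f_le (G := G) m; omega), mul_zero, sub_zero]
      exact coeff_f_self_ne_zero hG hm.ge
    have h3 : F ≠ 0 := by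
      intro h
      rw [h, coeff_zero] at h2
      exact h2 rfl
    have h4 : F.natDegree ≤ m + 2 := by
      refine (natDegree_sub_le _ _).trans (max_le ?_ ?_)
      · refine natDegree_mul_le.trans ?_
        have := natDegree_f_le (G := G) (m + 1)
        have := natDegree_X_le (R := ℝ)
        omega
      · refine (natDegree_C_mul_le _ _).trans ?_
        have := natDegree_f_le (G := G) m
        omega
    have h5 : eigenvalueFinset G ⊆ F.roots.toFinset := fun t ht => by
      rw [Multiset.mem_toFinset, mem_roots h3]
      exact aeval_eq_zero_iff.1 h1 t ht
    have h6 := (Finset.card_le_card h5).trans (Multiset.toFinset_card_le _)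
    have h7 := F.card_roots'
    omega
  · by_contra! h
    refine aeval_adj_ne_zero hG.1 (q := ∏ t ∈ eigenvalueFinset G, (Polynomial.X - C t)) ?_ ?_ ?_
    · exact Finset.prod_ne_zero_iff.2 fun t _ => X_sub_C_ne_zero t
    · rw [natDegree_prod_of_monic _ _ fun t _ => monic_X_sub_C t]
      simp
      omega
    · refine aeval_eq_zero_iff.2 fun t ht => ?_
      rw [eval_prod, Finset.prod_eq_zero ht]
      simp

theorem exists_theta_eq (hG : IsDistanceRegular G) (hb : G.IsBipartite) (hD : 1 ≤ G.diam) {t : ℝ}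
    (ht : t ∈ spectrum ℝ (adj G)) : ∃ i ≤ G.diam, theta G i = t := by
  have h1 : t ∈ (eigenvalueFinset G).sort (· ≥ ·) := by
    rw [Finset.mem_sort, mem_eigenvalueFinset]
    exact ht
  obtain ⟨i, hi, h⟩ := List.getElem_of_mem h1
  refine ⟨i, ?_, ?_⟩
  · rw [Finset.length_sort, card_eigenvalueFinset hG hb hD] at hi
    omega
  · rw [theta, ← h]
    exact List.getD_eq_getElem _ _ hi

theorem theta_mem_spectrum (hG : IsDistanceRegular G) (hb : G.IsBipartite) (hD : 1 ≤ G.diam)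
    {i : ℕ} (hi : i ≤ G.diam) : theta G i ∈ spectrum ℝ (adj G) := by
  have h : i < ((eigenvalueFinset G).sort (· ≥ ·)).length := by
    rw [Finset.length_sort, card_eigenvalueFinset hG hb hD]
    omega
  rw [← mem_eigenvalueFinset, ← Finset.mem_sort (· ≥ ·), theta]
  change ((eigenvalueFinset G).sort (· ≥ ·)).getD i 0 ∈ _
  rw [List.getD_eq_getElem _ _ h]
  exact List.getElem_mem h

theorem theta_lt_theta (hG : IsDistanceRegular G) (hb : G.IsBipartite) (hD : 1 ≤ G.diam)
    {i j : ℕ} (hij : i < j) (hj : j ≤ G.diam) : theta G j < theta G i := by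
  have h : j < ((eigenvalueFinset G).sort (· ≥ ·)).length := by
    rw [Finset.length_sort, card_eigenvalueFinset hG hb hD]
    omega
  have h1 := (eigenvalueFinset G).sortedGT_sort
  rw [theta, theta]
  change ((eigenvalueFinset G).sort (· ≥ ·)).getD j 0 < ((eigenvalueFinset G).sort (· ≥ ·)).getD i 0
  rw [List.getD_eq_getElem _ _ h, List.getD_eq_getElem _ _ (hij.trans h)]
  exact List.pairwise_iff_getElem.1 h1.pairwise i j _ h hij

theorem theta_le_theta (hG : IsDistanceRegular G) (hb : G.IsBipartite) (hD : 1 ≤ G.diam)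
    {i j : ℕ} (hij : i ≤ j) (hj : j ≤ G.diam) : theta G j ≤ theta G i := by
  rcases hij.eq_or_lt with rfl | h
  · rfl
  · exact (theta_lt_theta hG hb hD h hj).le

theorem theta_zero (hG : IsDistanceRegular G) (hb : G.IsBipartite) (hD : 1 ≤ G.diam) :
    theta G 0 = valency G := by
  obtain ⟨i, hi, h⟩ := exists_theta_eq hG hb hD (valency_mem_spectrum hG)
  apply le_antisymm
  · exact (le_abs_self _).trans (abs_le_valency hG (theta_mem_spectrum hG hb hD (Nat.zero_le _)))
  · rw [← h]
    exact theta_le_theta hG hb hD (Nat.zero_le _) hi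

/-- Negation reverses the order of a spectrum closed under negation. Each inequality is an induction
on j in which strict monotonicity pushes the index on by one. -/
theorem neg_theta (hG : IsDistanceRegular G) (hb : G.IsBipartite) (hD : 1 ≤ G.diam) {i : ℕ}
    (hi : i ≤ G.diam) : -theta G i = theta G (G.diam - i) := by
  have lower : ∀ j ≤ G.diam, theta G (G.diam - j) ≤ -theta G j := by
    intro j hj
    induction j with
    | zero =>
      obtain ⟨i, hi, h⟩ := exists_theta_eq hG hb hD
        (neg_mem_spectrum hG hb (theta_mem_spectrum hG hb hD (Nat.zero_le G.diam)))
      rw [← h]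
      exact theta_le_theta hG hb hD hi (Nat.sub_le _ _)
    | succ j ih =>
      obtain ⟨i, hi, h⟩ := exists_theta_eq hG hb hD
        (neg_mem_spectrum hG hb (theta_mem_spectrum hG hb hD hj))
      have h1 := theta_lt_theta hG hb hD (Nat.lt_succ_self j) hj
      have h2 := ih (by omega)
      rw [← h]
      refine theta_le_theta hG hb hD ?_ (Nat.sub_le _ _)
      by_contra! h3
      have h4 := theta_le_theta hG hb hD (show G.diam - j ≤ i by omega) hi
      linarith
  have upper : ∀ j ≤ G.diam, -theta G (G.diam - j) ≤ theta G j := by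
    intro j hj
    obtain ⟨i, hi, h⟩ := exists_theta_eq hG hb hD
      (neg_mem_spectrum hG hb (theta_mem_spectrum hG hb hD (Nat.sub_le G.diam j)))
    rw [← h]
    induction j generalizing i with
    | zero => exact theta_le_theta hG hb hD (Nat.zero_le _) hi
    | succ j ih =>
      obtain ⟨l, hl, h'⟩ := exists_theta_eq hG hb hD
        (neg_mem_spectrum hG hb (theta_mem_spectrum hG hb hD (Nat.sub_le G.diam j)))
      have h1 := theta_lt_theta hG hb hD (show G.diam - (j + 1) < G.diam - j by omega)
        (Nat.sub_le _ _)
      have h2 := ih (by omega) l hl h'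
      refine theta_le_theta hG hb hD ?_ hi
      by_contra! h3
      have h4 := theta_le_theta hG hb hD (show i ≤ j by omega) (by omega)
      linarith
  have h1 := lower i hi
  have h2 := upper i hi
  linarith

theorem theta_half_nonneg (hG : IsDistanceRegular G) (hb : G.IsBipartite) (hD : 1 ≤ G.diam) :
    0 ≤ theta G (G.diam / 2) := by
  have h1 := neg_theta hG hb hD (i := G.diam / 2) (by omega)
  have h2 := theta_le_theta hG hb hD (show G.diam / 2 ≤ G.diam - G.diam / 2 by omega) (by omega)
  linarith

theorem sq_mem_Icc_of_mem_spectrum (hG : IsDistanceRegular G) (hb : G.IsBipartite)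
    (hD : 1 ≤ G.diam) {t : ℝ} (ht : t ∈ spectrum ℝ (adj G)) (hk : t ^ 2 ≠ (valency G : ℝ) ^ 2) :
    t ^ 2 ∈ Set.Icc (theta G (G.diam / 2) ^ 2) (theta G 1 ^ 2) := by
  have key : ∀ i, i ≤ G.diam - i → theta G i ^ 2 ≠ (valency G : ℝ) ^ 2 →
      theta G i ^ 2 ∈ Set.Icc (theta G (G.diam / 2) ^ 2) (theta G 1 ^ 2) := by
    intro i hi hne
    have h0 : i ≠ 0 := by
      rintro rfl
      rw [theta_zero hG hb hD] at hne
      exact hne rfl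
    have h1 := theta_half_nonneg hG hb hD
    have h2 := theta_le_theta hG hb hD (show i ≤ G.diam / 2 by omega) (by omega)
    have h3 := theta_le_theta hG hb hD (show 1 ≤ i by omega) (by omega)
    exact ⟨pow_le_pow_left₀ h1 h2 2, pow_le_pow_left₀ (h1.trans h2) h3 2⟩
  obtain ⟨i, hi, rfl⟩ := exists_theta_eq hG hb hD ht
  rcases le_total i (G.diam - i) with h | h
  · exact key i h hk
  · have h1 := neg_theta hG hb hD hi
    rw [← neg_sq (theta G i), h1] at hk ⊢
    exact key _ (by omega) hk

/-- If a root `s` of `P_i` is not separated by the squares of the eigenvalues other than `±k`,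
then a polynomial of small degree vanishes at all eigenvalues. -/
theorem exists_eval_eq_zero_of_eval_P_eq_zero (hG : IsDistanceRegular G) (hb : G.IsBipartite)
    (hD : 2 ≤ G.diam) {i : ℕ} (hi : i ≤ G.diam) {s : ℝ} (hs : (P G i).eval s = 0)
    (h : (∀ t ∈ spectrum ℝ (adj G), t ^ 2 ≠ (valency G : ℝ) ^ 2 → t ^ 2 ≤ s) ∨
      ∀ t ∈ spectrum ℝ (adj G), t ^ 2 ≠ (valency G : ℝ) ^ 2 → s ≤ t ^ 2) :
    ∃ q : ℝ[X], q ≠ 0 ∧ q.natDegree + 2 ≤ i ∧ ∀ t ∈ spectrum ℝ (adj G),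
      ((valency G : ℝ) ^ 2 - t ^ 2) * (t ^ 2 - s) * q.eval t = 0 := by
  obtain ⟨q, hq⟩ := exists_p_eq_mul_of_eval_P_eq_zero hs
  have h0 := p_ne_zero hG hi
  rw [hq] at h0
  have hq0 : q ≠ 0 := right_ne_zero_of_mul h0
  have hdeg : q.natDegree + 2 ≤ i := by
    have h1 := natDegree_p_le (G := G) i
    rw [hq, natDegree_mul (left_ne_zero_of_mul h0) hq0, natDegree_X_pow_sub_C] at h1
    omega
  refine ⟨q, hq0, hdeg, ?_⟩
  -- In r = (k² - λ²)(λ² - s) q² the sign on the spectrum is that of λ² - s, whereas the trace of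
  -- r(A) is zero because q has degree below i. So r vanishes on the spectrum.
  set r : ℝ[X] := (C (valency G : ℝ) ^ 2 - Polynomial.X ^ 2) * p G i * q with hr
  have htr : (aeval (adj G) r).trace = 0 := by
    rw [hr, map_mul, valency_sq_sub_mul_pA hG hb hD hi, sub_mul, Matrix.trace_sub, smul_mul_assoc,
      smul_mul_assoc, Matrix.trace_smul, Matrix.trace_smul,
      trace_distMatrix_mul_aeval (by omega), trace_distMatrix_mul_aeval (by omega)]
    simp
  have hev : ∀ t, r.eval t = ((valency G : ℝ) ^ 2 - t ^ 2) * (t ^ 2 - s) * q.eval t ^ 2 := by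
    intro t
    rw [hr, hq]
    simp
    ring
  have hk : ∀ t ∈ spectrum ℝ (adj G), 0 ≤ (valency G : ℝ) ^ 2 - t ^ 2 := by
    intro t ht
    have := sq_le_sq' (neg_le_of_abs_le (abs_le_valency hG ht)) (le_of_abs_le (abs_le_valency hG ht))
    linarith
  have hzero : ∀ t ∈ spectrum ℝ (adj G), r.eval t = 0 := by
    rcases h with h | h
    · have htr' : (aeval (adj G) (-r)).trace = 0 := by
        rw [map_neg, Matrix.trace_neg, htr, neg_zero]
      have h1 := adj_isHermitian.eval_eq_zero_of_trace_aeval_eq_zero (q := -r) (fun t ht => ?_)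
        htr'
      · simpa using h1
      · rw [eval_neg, hev]
        by_cases h2 : t ^ 2 = (valency G : ℝ) ^ 2
        · simp [h2]
        · have h3 := mul_nonneg (mul_nonneg (hk t ht) (sub_nonneg.2 (h t ht h2)))
            (sq_nonneg (q.eval t))
          linarith
    · refine adj_isHermitian.eval_eq_zero_of_trace_aeval_eq_zero (fun t ht => ?_) htr
      rw [hev]
      by_cases h2 : t ^ 2 = (valency G : ℝ) ^ 2
      · simp [h2]
      · exact mul_nonneg (mul_nonneg (hk t ht) (sub_nonneg.2 (h t ht h2)))
          (sq_nonneg (q.eval t))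
  intro t ht
  have h1 := hzero t ht
  rw [hev] at h1
  simp only [mul_eq_zero, pow_eq_zero_iff two_ne_zero] at h1 ⊢
  exact h1

theorem exists_eval_ne_zero (hG : IsDistanceRegular G) {q : ℝ[X]} (hq : q ≠ 0)
    (h : q.natDegree ≤ G.diam) : ∃ t ∈ spectrum ℝ (adj G), q.eval t ≠ 0 := by
  by_contra! h1
  exact aeval_adj_ne_zero hG.1 hq h (adj_isHermitian.aeval_eq_zero_iff q |>.2 h1)

theorem natDegree_sq_sub_mul_le (s : ℝ) (q : ℝ[X]) :
    ((C s - Polynomial.X ^ 2) * q).natDegree ≤ q.natDegree + 2 := by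
  refine natDegree_mul_le.trans ?_
  have : (C s - Polynomial.X ^ 2 : ℝ[X]).natDegree ≤ 2 := by compute_degree
  omega

theorem C_sub_X_sq_ne_zero (s : ℝ) : (C s - Polynomial.X ^ 2 : ℝ[X]) ≠ 0 := by
  rw [← neg_ne_zero, neg_sub]
  exact X_pow_sub_C_ne_zero two_pos s

theorem eval_P_ne_zero (hG : IsDistanceRegular G) (hb : G.IsBipartite)
    (hD : 2 ≤ G.diam) {i : ℕ} (hi : i ≤ G.diam) {s : ℝ}
    (h : theta G 1 ^ 2 < s ∨ s < theta G (G.diam / 2) ^ 2) : (P G i).eval s ≠ 0 := by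
  intro hs
  have hI := fun t ht => sq_mem_Icc_of_mem_spectrum hG hb (by omega) (t := t) ht
  obtain ⟨q, hq0, hdeg, hq⟩ := exists_eval_eq_zero_of_eval_P_eq_zero hG hb hD hi hs
    (h.imp (fun h t ht hk => (hI t ht hk).2.trans h.le) fun h t ht hk => h.le.trans (hI t ht hk).1)
  -- The polynomial (k² - λ²) q has degree at most i ≤ D, so it is nonzero at some eigenvalue t;
  -- there t² = s, against s lying strictly outside the interval.
  obtain ⟨t, ht, h1⟩ := exists_eval_ne_zero hG
    (mul_ne_zero (C_sub_X_sq_ne_zero ((valency G : ℝ) ^ 2)) hq0)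
    ((natDegree_sq_sub_mul_le _ _).trans (hdeg.trans hi))
  simp only [eval_mul, eval_sub, eval_C, eval_pow, eval_X, ne_eq, mul_eq_zero, not_or] at h1
  have h2 := hI t ht fun h2 => h1.1 (by rw [h2, sub_self])
  have h3 := hq t ht
  simp only [mul_eq_zero, h1.1, h1.2, or_false, false_or] at h3
  rcases h with h | h
  · linarith [h2.2]
  · linarith [h2.1]

theorem b_two_mem_Ioo (hG : IsDistanceRegular G) (hb : G.IsBipartite) (hD : 4 ≤ G.diam) :
    (b G 2 : ℝ) ∈ Set.Ioo (theta G (G.diam / 2) ^ 2) (theta G 1 ^ 2) := by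
  have hI := fun t ht => sq_mem_Icc_of_mem_spectrum hG hb (by omega) (t := t) ht
  have hs : (P G 2).eval (b G 2 : ℝ) = 0 := by
    have h1 := congrArg (eval (b G 2 : ℝ)) (c_mul_P_two hG hb (by omega))
    simp only [eval_mul, eval_C, eval_sub, eval_X, sub_self, mul_eq_zero, Nat.cast_eq_zero] at h1
    exact h1.resolve_left (c_pos hG two_ne_zero (by omega)).ne'
  have key : ¬((∀ t ∈ spectrum ℝ (adj G), t ^ 2 ≠ (valency G : ℝ) ^ 2 → t ^ 2 ≤ (b G 2 : ℝ)) ∨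
      ∀ t ∈ spectrum ℝ (adj G), t ^ 2 ≠ (valency G : ℝ) ^ 2 → (b G 2 : ℝ) ≤ t ^ 2) := by
    intro h
    obtain ⟨q, hq0, hdeg, hq⟩ := exists_eval_eq_zero_of_eval_P_eq_zero hG hb (by omega)
      (show 2 ≤ G.diam by omega) hs h
    -- Here s may be an endpoint, so the factor b_2 - λ² is kept. As q is constant the product has
    -- degree at most 4 ≤ D and cannot vanish on the whole spectrum.
    have h1 := natDegree_sq_sub_mul_le (b G 2 : ℝ) q
    have h2 := natDegree_sq_sub_mul_le ((valency G : ℝ) ^ 2)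
      ((C (b G 2 : ℝ) - Polynomial.X ^ 2) * q)
    obtain ⟨t, ht, h3⟩ := exists_eval_ne_zero hG (mul_ne_zero
      (C_sub_X_sq_ne_zero ((valency G : ℝ) ^ 2))
      (mul_ne_zero (C_sub_X_sq_ne_zero (b G 2 : ℝ)) hq0)) (by omega)
    apply h3
    have h4 := hq t ht
    simp only [eval_mul, eval_sub, eval_C, eval_pow, eval_X]
    linarith
  constructor
  · by_contra! h
    exact key (Or.inr fun t ht hk => h.trans (hI t ht hk).1)
  · by_contra! h
    exact key (Or.inl fun t ht hk => (hI t ht hk).2.trans h)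

/-- `ψ` lies outside the interval spanned by the squares of the eigenvalues other than `±k`. -/
theorem psi_outside (hG : IsDistanceRegular G) (hb : G.IsBipartite) (hD : 4 ≤ G.diam) {η : ℝ}
    (hη₁ : tilde G (theta G 1) < η) (hη₂ : η < tilde G (theta G (G.diam / 2))) (hη : η ≠ -1) :
    theta G 1 ^ 2 < psi G η ∨ psi G η < theta G (G.diam / 2) ^ 2 := by
  obtain ⟨h1, h2⟩ := b_two_mem_Ioo hG hb hD
  have hb2 : (0 : ℝ) < b G 2 := by exact_mod_cast b_pos hG (by omega)
  have hb3 : (0 : ℝ) < b G 3 := by exact_mod_cast b_pos hG (by omega)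
  have hpos : (0 : ℝ) < b G 2 * b G 3 := mul_pos hb2 hb3
  -- The sign of 1 + η decides on which side of b_2 the number ψ lies; only the bound with θ_1
  -- matters when η < -1, only the one with θ_d when η > -1.
  have hpsi : psi G η = b G 2 - b G 2 * b G 3 / (1 + η) := by rw [psi]; ring
  rw [tilde] at hη₁ hη₂
  rw [hpsi]
  rcases lt_or_gt_of_ne hη with h | h
  · left
    have h3 : 0 < -(1 + η) := by linarith
    have h4 : -(1 + η) < b G 2 * b G 3 / (theta G 1 ^ 2 - b G 2) := by linarith
    rw [lt_div_iff₀ (by linarith), mul_comm, ← lt_div_iff₀ h3, div_neg] at h4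
    linarith
  · right
    have h3 : 0 < 1 + η := by linarith
    have h4 : 1 + η < b G 2 * b G 3 / (b G 2 - theta G (G.diam / 2) ^ 2) := by
      rw [← neg_sub (theta G (G.diam / 2) ^ 2), div_neg]
      linarith
    rw [lt_div_iff₀ (by linarith), mul_comm, ← lt_div_iff₀ h3] at h4
    linarith

end Eigenvalues

/-! ### The vectors E*_j A_i v and the action of A on them. -/

section Module

set_option linter.unusedSectionVars false

variable {X : Type*} [Fintype X] [DecidableEq X] {G : SimpleGraph X}

theorem act_apply (B : Matrix X X ℂ) (w : EuclideanSpace ℂ X) (y : X) :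
    act B w y = ∑ z, B y z * w z := by
  simp [act, Matrix.mulVec, dotProduct]

theorem act_mul (B C : Matrix X X ℂ) (w : EuclideanSpace ℂ X) :
    act (B * C) w = act B (act C w) := by
  simp [act]

theorem act_one (w : EuclideanSpace ℂ X) : act 1 w = w := by
  simp [act]

theorem act_add (B C : Matrix X X ℂ) (w : EuclideanSpace ℂ X) :
    act (B + C) w = act B w + act C w := by
  simp [act]

theorem act_real_smul (r : ℝ) (B : Matrix X X ℂ) (w : EuclideanSpace ℂ X) :
    act (r • B) w = (r : ℂ) • act B w := by
  ext y
  simp [act_apply, Finset.mul_sum, mul_assoc]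

theorem inner_act_left {B : Matrix X X ℂ} (hB : B.IsHermitian) (u w : EuclideanSpace ℂ X) :
    inner ℂ (act B u) w = inner ℂ u (act B w) :=
  Matrix.isSymmetric_toEuclideanLin_iff.2 hB u w

theorem dualIdem_apply (x : X) (j : ℕ) (w : EuclideanSpace ℂ X) (y : X) :
    act (dualIdem G x j) w y = if G.dist x y = j then w y else 0 := by
  simp [act, dualIdem, Matrix.mulVec_diagonal]

theorem dualIdem_isHermitian (x : X) (j : ℕ) : (dualIdem G x j).IsHermitian := by
  rw [dualIdem, Matrix.isHermitian_diagonal_iff]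
  intro y
  rw [isSelfAdjoint_iff]
  split_ifs <;> simp

theorem dualIdem_act_self (x : X) (j : ℕ) (w : EuclideanSpace ℂ X) :
    act (dualIdem G x j) (act (dualIdem G x j) w) = act (dualIdem G x j) w := by
  ext y
  simp only [dualIdem_apply]
  split_ifs <;> rfl

theorem dualIdem_act_of_ne (x : X) {i j : ℕ} (h : i ≠ j) (w : EuclideanSpace ℂ X) :
    act (dualIdem G x i) (act (dualIdem G x j) w) = 0 := by
  ext y
  simp only [dualIdem_apply, PiLp.zero_apply]
  split_ifs with h1 h2
  · exact absurd (h1.symm.trans h2) h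
  · rfl
  · rfl

theorem sum_dualIdem (hc : G.Connected) (x : X) (w : EuclideanSpace ℂ X) :
    ∑ j ∈ Finset.range (G.diam + 1), act (dualIdem G x j) w = w := by
  ext y
  simp only [WithLp.ofLp_sum, Finset.sum_apply, dualIdem_apply]
  rw [Finset.sum_ite_eq, if_pos]
  have := dist_le_diam hc x y
  rw [Finset.mem_range]
  omega

/-- The vector `E*_j A_i v`. -/
noncomputable def level (G : SimpleGraph X) (x : X) (v : EuclideanSpace ℂ X) (j i : ℕ) :
    EuclideanSpace ℂ X :=
  act (dualIdem G x j) (act (distMatrix G i) v)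

/-- The operator `E*_j A`. -/
noncomputable def step (G : SimpleGraph X) (x : X) (j : ℕ) :
    EuclideanSpace ℂ X →ₗ[ℂ] EuclideanSpace ℂ X :=
  act (dualIdem G x j) ∘ₗ act (adj G)

theorem step_apply (x : X) (j : ℕ) (w : EuclideanSpace ℂ X) :
    step G x j w = act (dualIdem G x j) (act (adj G) w) := rfl

theorem vec_eq_level (x : X) (v : EuclideanSpace ℂ X) (i : ℕ) :
    vec G x v i = level G x v (i + 2) i := by
  rw [vec, act_mul, level]

theorem level_apply (x : X) (v : EuclideanSpace ℂ X) (j i : ℕ) (y : X) :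
    level G x v j i y =
      if G.dist x y = j then ∑ z, (if G.dist y z = i then v z else 0) else 0 := by
  rw [level, dualIdem_apply, act_apply]
  simp [distMatrix]

theorem dualIdem_level (x : X) (v : EuclideanSpace ℂ X) (j i : ℕ) :
    act (dualIdem G x j) (level G x v j i) = level G x v j i :=
  dualIdem_act_self _ _ _

/-- `E*_{h+1} A = E*_{h+1} A E*_h + E*_{h+1} A E*_{h+2}`. -/
theorem step_eq (hc : G.Connected) (hb : G.IsBipartite) (x : X) (h : ℕ) (w : EuclideanSpace ℂ X) :
    step G x (h + 1) w = step G x (h + 1) (act (dualIdem G x h) w) +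
      step G x (h + 1) (act (dualIdem G x (h + 2)) w) := by
  ext y
  simp only [step_apply, PiLp.add_apply, dualIdem_apply, act_apply (adj G)]
  split_ifs with hy
  · rw [← Finset.sum_add_distrib]
    refine Finset.sum_congr rfl fun z _ => ?_
    by_cases hz : G.dist y z = 1
    · have h1 := even_dist_add_dist_add_dist hc hb x y z
      have h2 := hc.dist_triangle (u := x) (v := y) (w := z)
      have h3 := hc.dist_triangle (u := x) (v := z) (w := y)
      rw [G.dist_comm (u := z) (v := y)] at h3
      rw [hz] at h1 h2 h3
      have h4 : G.dist x z = h ∨ G.dist x z = h + 2 := by grind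
      rcases h4 with h4 | h4 <;> simp [h4]
    · simp [adj, distMatrix, hz]
  · simp

/-- The relation `A A_{i+1} = c_{i+2} A_{i+2} + b_i A_i`, read at level `h + 1`. -/
theorem step_level_add_step_level (hG : IsDistanceRegular G) (hb : G.IsBipartite) (x : X)
    (v : EuclideanSpace ℂ X) (h i : ℕ) :
    step G x (h + 1) (level G x v h (i + 1)) + step G x (h + 1) (level G x v (h + 2) (i + 1)) =
      ((c G (i + 2) : ℝ) : ℂ) • level G x v (h + 1) (i + 2) +
        ((b G i : ℝ) : ℂ) • level G x v (h + 1) i := by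
  rw [level, level, ← step_eq hG.1 hb, step_apply, ← act_mul (adj G),
    adj_mul_distMatrix_succ hG hb, act_add, act_real_smul, act_real_smul, map_add, map_smul,
    map_smul]
  rfl

theorem step_level_zero (hG : IsDistanceRegular G) (hb : G.IsBipartite) (x : X)
    (v : EuclideanSpace ℂ X) (h : ℕ) :
    step G x (h + 1) (level G x v h 0) + step G x (h + 1) (level G x v (h + 2) 0) =
      level G x v (h + 1) 1 := by
  rw [level, level, ← step_eq hG.1 hb, step_apply, distMatrix_zero hG.1, act_one]
  rfl

section Support

variable {x : X} {v : EuclideanSpace ℂ X}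

theorem level_eq_zero (hc : G.Connected) (hb : G.IsBipartite)
    (hv : ∀ y, G.dist x y ≠ 2 → v y = 0) {i j : ℕ} (h1 : j ≠ i + 2) (h2 : j ≠ i) (h3 : i ≠ j + 2) :
    level G x v j i = 0 := by
  ext y
  rw [level_apply, PiLp.zero_apply]
  split_ifs with hy
  · refine Finset.sum_eq_zero fun z _ => ?_
    split_ifs with hz
    · apply hv
      intro h4
      have h5 := even_dist_add_dist_add_dist hc hb x y z
      have h6 := hc.dist_triangle (u := x) (v := z) (w := y)
      have h7 := hc.dist_triangle (u := y) (v := x) (w := z)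
      rw [G.dist_comm (u := z) (v := y)] at h6
      rw [G.dist_comm (u := y) (v := x)] at h7
      grind
    · rfl
  · rfl

/-- From a vertex at distance i + 2 from x, every vertex at distance 2 from x is at distance i, i +
2 or i + 4. So each coordinate at that level is the sum of all entries of v. -/
theorem level_add_level_add_level (hc : G.Connected) (hb : G.IsBipartite)
    (hv : ∀ y, G.dist x y ≠ 2 → v y = 0) (hs : ∑ z, v z = 0) (i : ℕ) :
    level G x v (i + 2) i + level G x v (i + 2) (i + 2) + level G x v (i + 2) (i + 4) = 0 := by
  ext y
  simp only [PiLp.add_apply, PiLp.zero_apply, level_apply]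
  split_ifs with hy
  · rw [← Finset.sum_add_distrib, ← Finset.sum_add_distrib]
    refine Eq.trans ?_ hs
    refine Finset.sum_congr rfl fun z _ => ?_
    by_cases hz : G.dist x z = 2
    · have h5 := even_dist_add_dist_add_dist hc hb x y z
      have h6 := hc.dist_triangle (u := x) (v := z) (w := y)
      have h7 := hc.dist_triangle (u := y) (v := x) (w := z)
      rw [G.dist_comm (u := z) (v := y)] at h6
      rw [G.dist_comm (u := y) (v := x)] at h7
      have h8 : G.dist y z = i ∨ G.dist y z = i + 2 ∨ G.dist y z = i + 4 := by grind
      rcases h8 with h8 | h8 | h8 <;> simp [h8]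
    · simp [hv z hz]
  · simp

theorem act_distMatrix_add_two (hc : G.Connected) (hb : G.IsBipartite)
    (hv : ∀ y, G.dist x y ≠ 2 → v y = 0) (i : ℕ) :
    act (distMatrix G (i + 2)) v =
      level G x v i (i + 2) + level G x v (i + 2) (i + 2) + level G x v (i + 4) (i + 2) := by
  ext y
  simp only [PiLp.add_apply, level]
  by_cases h1 : G.dist x y = i
  · simp [dualIdem_apply, h1]
  by_cases h2 : G.dist x y = i + 2
  · simp [dualIdem_apply, h2]
  by_cases h3 : G.dist x y = i + 4
  · simp [dualIdem_apply, h3]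
  have h4 : level G x v (G.dist x y) (i + 2) = 0 :=
    level_eq_zero hc hb hv (by omega) (by omega) (by omega)
  have h5 := congrArg (fun w : EuclideanSpace ℂ X => w y) h4
  simp only [level, dualIdem_apply, if_true, PiLp.zero_apply] at h5
  simp [dualIdem_apply, h5]

theorem level_two_zero (hc : G.Connected) (hv : ∀ y, G.dist x y ≠ 2 → v y = 0) :
    level G x v 2 0 = v := by
  rw [level, distMatrix_zero hc, act_one]
  ext y
  rw [dualIdem_apply]
  split_ifs with h
  · rfl
  · exact (hv y h).symm

/-- `E*_{i+3} A E*_{i+2} A_i v = c_{i+1} E*_{i+3} A_{i+1} v`. -/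
theorem step_up (hG : IsDistanceRegular G) (hb : G.IsBipartite) (hD : 1 ≤ G.diam)
    (hv : ∀ y, G.dist x y ≠ 2 → v y = 0) : ∀ i,
    step G x (i + 3) (level G x v (i + 2) i) =
      ((c G (i + 1) : ℝ) : ℂ) • level G x v (i + 3) (i + 1)
  | 0 => by
    have h := step_level_zero hG hb x v 2
    rw [level_eq_zero (j := 2 + 2) (i := 0) hG.1 hb hv (by omega) (by omega) (by omega), map_zero,
      add_zero] at h
    simpa [c_one hG hD] using h
  | i + 1 => by
    have h := step_level_add_step_level hG hb x v (i + 3) i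
    rw [level_eq_zero (j := i + 3 + 2) (i := i + 1) hG.1 hb hv (by omega) (by omega) (by omega),
      level_eq_zero (j := i + 3 + 1) (i := i) hG.1 hb hv (by omega) (by omega) (by omega), map_zero,
      add_zero, smul_zero, add_zero] at h
    exact h

/-- `E*_{i+1} A E*_{i+2} A_{i+4} v = b_{i+3} E*_{i+1} A_{i+3} v`. -/
theorem step_down (hG : IsDistanceRegular G) (hb : G.IsBipartite)
    (hv : ∀ y, G.dist x y ≠ 2 → v y = 0) (i : ℕ) :
    step G x (i + 1) (level G x v (i + 2) (i + 4)) =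
      ((b G (i + 3) : ℝ) : ℂ) • level G x v (i + 1) (i + 3) := by
  have h := step_level_add_step_level hG hb x v i (i + 3)
  rw [level_eq_zero (j := i) (i := i + 3 + 1) hG.1 hb hv (by omega) (by omega) (by omega),
    level_eq_zero (j := i + 1) (i := i + 3 + 2) hG.1 hb hv (by omega) (by omega) (by omega),
    map_zero, zero_add, smul_zero, zero_add] at h
  exact h

/-- The action of `A` from level `m + 3` to level `m + 2`. -/
theorem step_mixed (hG : IsDistanceRegular G) (hb : G.IsBipartite)
    (hv : ∀ y, G.dist x y ≠ 2 → v y = 0) (hs : ∑ z, v z = 0) {m : ℕ} (hm : m + 2 ≤ G.diam) :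
    step G x (m + 2) (level G x v (m + 3) (m + 1)) =
      step G x (m + 2) (level G x v (m + 1) (m + 3)) +
        ((b G (m + 2) : ℝ) : ℂ) • level G x v (m + 2) m -
          ((c G (m + 2) : ℝ) : ℂ) • level G x v (m + 2) (m + 4) := by
  have h1 := step_level_add_step_level hG hb x v (m + 1) (m + 2)
  have h2 := step_down hG hb hv (m + 1)
  have h3 := level_add_level_add_level hG.1 hb hv hs (m + 1)
  have h4 := level_add_level_add_level hG.1 hb hv hs m
  simp only [add_assoc, Nat.reduceAdd] at h1 h2 h3 h4
  have h5 := congrArg (step G x (m + 2)) h3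
  rw [map_add, map_add, map_zero, h2] at h5
  -- Both scalars equal k, unless m + 4 > D, in which case A_{m+4} = 0.
  have h6 : (((c G (m + 4) : ℝ) : ℂ) + ((b G (m + 4) : ℝ) : ℂ)) • level G x v (m + 2) (m + 4) =
      (((c G (m + 2) : ℝ) : ℂ) + ((b G (m + 2) : ℝ) : ℂ)) • level G x v (m + 2) (m + 4) := by
    by_cases h : m + 4 ≤ G.diam
    · rw [b_eq_sub hG hb h, b_eq_sub hG hb hm]
      push_cast
      congr 1
      ring
    · simp [level, distMatrix_eq_zero hG.1 (lt_of_not_ge h), act]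
  linear_combination (norm := module) h5 - h1 + (-((b G (m + 2) : ℝ) : ℂ)) • h4 - h6

theorem inner_level_of_ne (x : X) (v w : EuclideanSpace ℂ X) {i j h l : ℕ} (hij : i ≠ j) :
    inner ℂ (level G x v i h) (level G x w j l) = 0 := by
  rw [level, inner_act_left (dualIdem_isHermitian x i), level, dualIdem_act_of_ne x hij,
    inner_zero_right]

theorem inner_level_step (x : X) (v : EuclideanSpace ℂ X) (i j h l : ℕ) :
    inner ℂ (level G x v i h) (step G x i (level G x v j l)) =
      inner ℂ (step G x j (level G x v i h)) (level G x v j l) := by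
  rw [step_apply, step_apply, ← inner_act_left (dualIdem_isHermitian x i), dualIdem_level,
    inner_act_left (dualIdem_isHermitian x j), dualIdem_level, inner_act_left adj_isHermitian]

end Support

end Module

/-! ### Climbing a thin module of endpoint 2. -/

section Ladder

set_option linter.unusedSectionVars false

variable {X : Type*} [Fintype X] [DecidableEq X] {G : SimpleGraph X} {x : X}
  {W : Submodule ℂ (EuclideanSpace ℂ X)}

theorem distMatrix_mem (hG : IsDistanceRegular G) (hb : G.IsBipartite) (hD : 1 ≤ G.diam) (x : X)
    (i : ℕ) : distMatrix G i ∈ subconstituentAlgebra G x := by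
  have h1 : adj G ∈ boseMesner G := Algebra.subset_adjoin rfl
  have h2 : aeval (adj G) (f G i) ∈ boseMesner G := by
    rw [aeval_eq_sum_range]
    refine Subalgebra.sum_mem _ fun j _ => ?_
    rw [← algebraMap_smul ℂ]
    exact Subalgebra.smul_mem _ (Subalgebra.pow_mem _ h1 j) _
  rw [aeval_f hG hb hD] at h2
  exact (le_sup_left : boseMesner G ≤ _) h2

theorem dualIdem_mem (x : X) (i : ℕ) : dualIdem G x i ∈ subconstituentAlgebra G x :=
  (le_sup_right : dualBoseMesner G x ≤ _) (Algebra.subset_adjoin ⟨i, rfl⟩)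

theorem dualPart_le (hW : IsTModule G x W) (i : ℕ) : dualPart G x i W ≤ W := by
  rintro _ ⟨w, hw, rfl⟩
  exact hW _ (dualIdem_mem x i) w hw

theorem dualIdem_of_mem_dualPart {i : ℕ} {w : EuclideanSpace ℂ X} (hw : w ∈ dualPart G x i W) :
    act (dualIdem G x i) w = w := by
  obtain ⟨u, -, rfl⟩ := hw
  exact dualIdem_act_self x i u

theorem level_mem_dualPart (hG : IsDistanceRegular G) (hb : G.IsBipartite) (hD : 1 ≤ G.diam)
    (hW : IsTModule G x W) {v : EuclideanSpace ℂ X} (hv : v ∈ W) (j i : ℕ) :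
    level G x v j i ∈ dualPart G x j W :=
  ⟨_, hW _ (distMatrix_mem hG hb hD x i) v hv, rfl⟩

theorem dualPart_eq_bot (hend : endpoint G x W = 2) {i : ℕ} (hi : i < 2) :
    dualPart G x i W = ⊥ := by
  by_contra h
  rw [endpoint] at hend
  exact Nat.notMem_of_lt_sInf (hend ▸ hi) h

theorem exists_smul_eq_of_isThin (hthin : IsThin G x W) {i : ℕ} {w u : EuclideanSpace ℂ X}
    (hw : w ∈ dualPart G x i W) (hw0 : w ≠ 0) (hu : u ∈ dualPart G x i W) :
    ∃ a : ℂ, u = a • w := by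
  have h1 : Module.finrank ℂ (dualPart G x i W) = 1 := by
    refine le_antisymm (hthin i) (Nat.one_le_iff_ne_zero.2 fun h => ?_)
    rw [Submodule.finrank_eq_zero] at h
    rw [h, Submodule.mem_bot] at hw
    exact hw0 hw
  obtain ⟨a, ha⟩ := exists_smul_eq_of_finrank_eq_one h1 (x := ⟨w, hw⟩)
    (by simpa using hw0) ⟨u, hu⟩
  exact ⟨a, (congrArg Subtype.val ha).symm⟩

theorem apply_eq_zero_of_mem_dualPart {i : ℕ} {v : EuclideanSpace ℂ X}
    (hv : v ∈ dualPart G x i W) (y : X) (hy : G.dist x y ≠ i) : v y = 0 := by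
  rw [← dualIdem_of_mem_dualPart hv, dualIdem_apply, if_neg hy]

theorem level_eq_zero_of_lt_two (hG : IsDistanceRegular G) (hb : G.IsBipartite) (hD : 1 ≤ G.diam)
    (hW : IsTModule G x W) (hend : endpoint G x W = 2) {v : EuclideanSpace ℂ X} (hv : v ∈ W)
    {j : ℕ} (hj : j < 2) (i : ℕ) : level G x v j i = 0 := by
  have h := level_mem_dualPart hG hb hD hW hv j i
  rwa [dualPart_eq_bot hend hj, Submodule.mem_bot] at h

/-- The coordinate sum of v is the entry at x of E*_0 A_2 v, which vanishes because W has no part at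
level 0. -/
theorem sum_eq_zero (hG : IsDistanceRegular G) (hb : G.IsBipartite) (hD : 1 ≤ G.diam)
    (hW : IsTModule G x W) (hend : endpoint G x W = 2) {v : EuclideanSpace ℂ X}
    (hv : v ∈ dualPart G x 2 W) : ∑ z, v z = 0 := by
  have h := congrArg (fun w : EuclideanSpace ℂ X => w x)
    (level_eq_zero_of_lt_two hG hb hD hW hend (dualPart_le hW 2 hv) (show 0 < 2 by omega) 2)
  simp only [level_apply, G.dist_self, if_true, PiLp.zero_apply] at h
  rw [← h]
  refine Finset.sum_congr rfl fun z _ => ?_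
  split_ifs with hz
  · rfl
  · exact apply_eq_zero_of_mem_dualPart hv z hz

/-- `p_i(A) v = E*_{i+2} A_i v - E*_i A_{i+2} v`. -/
theorem act_pA (hG : IsDistanceRegular G) (hb : G.IsBipartite) (hD : 1 ≤ G.diam)
    (hW : IsTModule G x W) (hend : endpoint G x W = 2) {v : EuclideanSpace ℂ X}
    (hv : v ∈ dualPart G x 2 W) :
    ∀ i, act (pA G i) v = level G x v (i + 2) i - level G x v i (i + 2)
  | 0 => by
    rw [pA, p_zero, map_one, act_one,
      level_eq_zero_of_lt_two hG hb hD hW hend (dualPart_le hW 2 hv) two_pos, sub_zero,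
      level_two_zero hG.1 (apply_eq_zero_of_mem_dualPart hv)]
  | 1 => by
    have hz := fun i => level_eq_zero_of_lt_two hG hb hD hW hend (dualPart_le hW 2 hv)
      (one_lt_two) i
    rw [pA, p_one, aeval_f hG hb hD, hz, sub_zero, ← sum_dualIdem hG.1 x (act (distMatrix G 1) v)]
    change ∑ j ∈ Finset.range (G.diam + 1), level G x v j 1 = _
    refine Finset.sum_eq_single 3 (fun j _ hj => ?_) fun hj => ?_
    · by_cases h1 : j = 1
      · rw [h1, hz]
      · exact level_eq_zero hG.1 hb (apply_eq_zero_of_mem_dualPart hv) hj h1 (by omega)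
    · ext y
      have := dist_le_diam hG.1 x y
      rw [Finset.mem_range] at hj
      rw [level_apply, if_neg (by omega), PiLp.zero_apply]
  | i + 2 => by
    have hv2 := apply_eq_zero_of_mem_dualPart hv
    have h1 := act_pA hG hb hD hW hend hv i
    -- Adding A_{i+2} v cancels -E*_i A_{i+2} v, and the zero sum at level i + 2 turns the two terms
    -- there into -E*_{i+2} A_{i+4} v.
    have h2 := level_add_level_add_level hG.1 hb hv2 (sum_eq_zero hG hb hD hW hend hv) i
    have h3 : act (pA G (i + 2)) v = act (pA G i) v + act (distMatrix G (i + 2)) v := by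
      rw [pA, p_add_two, map_add, aeval_f hG hb hD, act_add, pA]
    rw [h3, h1, act_distMatrix_add_two hG.1 hb hv2]
    linear_combination (norm := module) h2

/-- A real solution `g`, `B` of the recurrence governing the action of `A` on a thin module gives
the ratios of the vectors `E*_{m+2} A_{m+4} v`, `E*_{m+2} A_m v` and of consecutive norms. -/
theorem ladder (hG : IsDistanceRegular G) (hb : G.IsBipartite) (hD : 1 ≤ G.diam)
    (hW : IsTModule G x W) (hthin : IsThin G x W) (hend : endpoint G x W = 2)
    {v : EuclideanSpace ℂ X} (hv : v ∈ dualPart G x 2 W) (hv0 : v ≠ 0) {g B : ℕ → ℝ}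
    (h0 : level G x v 2 4 = (g 0 : ℂ) • v)
    (hB : ∀ m, m + 3 ≤ G.diam → B m = b G (m + 2) + c G m * g (m - 1) - c G (m + 2) * g m)
    (hB0 : ∀ m, m + 3 ≤ G.diam → B m ≠ 0)
    (hg : ∀ m, m + 3 ≤ G.diam → g (m + 1) * B m = b G (m + 4) * g m) (m : ℕ)
    (hm : m + 2 ≤ G.diam) :
    level G x v (m + 2) m ≠ 0 ∧
      level G x v (m + 2) (m + 4) = (g m : ℂ) • level G x v (m + 2) m ∧
      (m + 3 ≤ G.diam → c G (m + 1) * ‖level G x v (m + 3) (m + 1)‖ ^ 2 =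
        B m * ‖level G x v (m + 2) m‖ ^ 2) := by
  have hvW := dualPart_le hW 2 hv
  have hv2 := apply_eq_zero_of_mem_dualPart hv
  have hs := sum_eq_zero hG hb hD hW hend hv
  have h00 := level_two_zero hG.1 hv2
  have hlow : ∀ m, m + 3 ≤ G.diam →
      level G x v (m + 2) (m + 4) = (g m : ℂ) • level G x v (m + 2) m →
      (m ≠ 0 → level G x v (m + 1) (m + 3) = (g (m - 1) : ℂ) • level G x v (m + 1) (m - 1)) →
      step G x (m + 2) (level G x v (m + 3) (m + 1)) = (B m : ℂ) • level G x v (m + 2) m := by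
    intro m hm h1 h2
    have h3 : step G x (m + 2) (level G x v (m + 1) (m + 3)) =
        ((c G m * g (m - 1) : ℝ) : ℂ) • level G x v (m + 2) m := by
      -- For m = 0 the truncated index makes g (m - 1) equal to g 0, harmlessly, as c_0 = 0.
      rcases m with _ | m
      · rw [level_eq_zero_of_lt_two hG hb hD hW hend hvW (by omega), c_zero, map_zero]
        simp
      · rw [h2 (Nat.succ_ne_zero m), map_smul, Nat.add_sub_cancel, step_up hG hb hD hv2, smul_smul]
        congr 1
        push_cast
        ring
    rw [step_mixed hG hb hv2 hs (by omega), h1, h3, hB m hm, smul_smul]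
    push_cast
    module
  have hnorm : ∀ m, step G x (m + 2) (level G x v (m + 3) (m + 1)) =
      (B m : ℂ) • level G x v (m + 2) m →
      c G (m + 1) * ‖level G x v (m + 3) (m + 1)‖ ^ 2 = B m * ‖level G x v (m + 2) m‖ ^ 2 := by
    intro m h1
    -- Raising and lowering are adjoint, so their coefficients compare the norms at adjacent levels.
    have h2 := inner_level_step (G := G) x v (m + 3) (m + 2) (m + 1) m
    rw [h1, step_up hG hb hD hv2, inner_smul_left, inner_smul_right, inner_self_eq_norm_sq_to_K,
      inner_self_eq_norm_sq_to_K, Complex.conj_ofReal] at h2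
    apply Complex.ofReal_injective
    push_cast at h2 ⊢
    exact h2
  have key : ∀ m, m + 2 ≤ G.diam → level G x v (m + 2) m ≠ 0 ∧
      level G x v (m + 2) (m + 4) = (g m : ℂ) • level G x v (m + 2) m ∧
      (m + 3 ≤ G.diam → step G x (m + 2) (level G x v (m + 3) (m + 1)) =
        (B m : ℂ) • level G x v (m + 2) m) := by
    intro m
    induction m with
    | zero =>
      intro hm
      have h1 : level G x v (0 + 2) (0 + 4) = (g 0 : ℂ) • level G x v (0 + 2) 0 := by
        rw [zero_add, zero_add, h0, h00]
      exact ⟨by rw [zero_add, h00]; exact hv0, h1, fun h => hlow 0 h h1 (by simp)⟩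
    | succ m ih =>
      intro hm
      obtain ⟨h1, h2, h3⟩ := ih (by omega)
      have h4 := h3 hm
      have h5 : level G x v (m + 3) (m + 1) ≠ 0 := by
        intro h
        have h6 := hnorm m h4
        rw [h, norm_zero, zero_pow two_ne_zero, mul_zero, eq_comm, mul_eq_zero,
          pow_eq_zero_iff two_ne_zero, norm_eq_zero] at h6
        exact h6.elim (hB0 m hm) h1
      obtain ⟨a, ha⟩ := exists_smul_eq_of_isThin hthin
        (level_mem_dualPart hG hb hD hW hvW (m + 3) (m + 1)) h5
        (level_mem_dualPart hG hb hD hW hvW (m + 3) (m + 5))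
      -- Thinness supplies some scalar a; lowering both sides by one level gives a B_m = b_{m+4}
      -- g_m, and B_m ≠ 0 determines a.
      have h7 : a = g (m + 1) := by
        have h8 := step_down hG hb hv2 (m + 1)
        simp only [add_assoc, Nat.reduceAdd] at h8
        rw [ha, map_smul, h4, h2, smul_smul, smul_smul] at h8
        have h9 := smul_left_injective ℂ h1 h8
        have h10 : ((g (m + 1) * B m : ℝ) : ℂ) = ((b G (m + 4) * g m : ℝ) : ℂ) := by rw [hg m hm]
        rw [Complex.ofReal_mul, Complex.ofReal_mul] at h10
        exact mul_right_cancel₀ (Complex.ofReal_ne_zero.2 (hB0 m hm)) (h9.trans h10.symm)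
      rw [h7] at ha
      exact ⟨h5, ha, fun h => hlow (m + 1) h ha fun _ => h2⟩
  obtain ⟨h1, h2, h3⟩ := key m hm
  exact ⟨h1, h2, fun h => hnorm m (h3 h)⟩

/-- Vectors at different levels are orthogonal, and by thinness a nonzero vector of E*_j W spans it;
levels 0 and 1 contribute nothing. -/
theorem linearIndependent_and_span_eq (hG : IsDistanceRegular G) (hb : G.IsBipartite)
    (hD : 2 ≤ G.diam) (hW : IsTModule G x W) (hthin : IsThin G x W) (hend : endpoint G x W = 2)
    {v : EuclideanSpace ℂ X} (hv : v ∈ dualPart G x 2 W)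
    (h0 : ∀ m, m + 2 ≤ G.diam → level G x v (m + 2) m ≠ 0) :
    LinearIndependent ℂ (fun i : Fin (G.diam - 1) => vec G x v i) ∧
      Submodule.span ℂ (Set.range fun i : Fin (G.diam - 1) => vec G x v i) = W := by
  have hvW := dualPart_le hW 2 hv
  have hmem := level_mem_dualPart hG hb (by omega) hW hvW
  simp_rw [vec_eq_level]
  refine ⟨linearIndependent_of_ne_zero_of_inner_eq_zero (fun i => h0 i (by omega))
    fun i j hij => inner_level_of_ne x v v ?_, le_antisymm ?_ ?_⟩
  · have := Fin.val_ne_of_ne hij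
    omega
  · rw [Submodule.span_le]
    rintro _ ⟨i, rfl⟩
    exact dualPart_le hW _ (hmem _ _)
  · intro w hw
    rw [← sum_dualIdem hG.1 x w]
    refine Submodule.sum_mem _ fun j hj => ?_
    have hwj : act (dualIdem G x j) w ∈ dualPart G x j W := ⟨w, hw, rfl⟩
    rcases Nat.lt_or_ge j 2 with h | h
    · rw [dualPart_eq_bot hend h, Submodule.mem_bot] at hwj
      rw [hwj]
      exact Submodule.zero_mem _
    · obtain ⟨m, rfl⟩ := Nat.exists_eq_add_of_le' h
      rw [Finset.mem_range] at hj
      obtain ⟨a, ha⟩ := exists_smul_eq_of_isThin hthin (hmem (m + 2) m) (h0 m (by omega)) hwj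
      rw [ha]
      exact Submodule.smul_mem _ _ (Submodule.subset_span ⟨⟨m, by omega⟩, rfl⟩)

/-- `E*_2 A_4 v = -(1 + η) v`. -/
theorem level_two_four (hG : IsDistanceRegular G) (hb : G.IsBipartite) (hD : 1 ≤ G.diam)
    (hW : IsTModule G x W) (hend : endpoint G x W = 2) {v : EuclideanSpace ℂ X}
    (hv : v ∈ dualPart G x 2 W) {η : ℝ} (hη : IsLocalEigenvalue G x W η) :
    level G x v 2 4 = ((-(1 + η) : ℝ) : ℂ) • v := by
  have hv2 := apply_eq_zero_of_mem_dualPart hv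
  have h1 := level_add_level_add_level hG.1 hb hv2 (sum_eq_zero hG hb hD hW hend hv) 0
  simp only [zero_add] at h1
  have h2 : level G x v 2 2 = (η : ℂ) • v := by
    have h3 := hη.2 v hv
    rwa [act_mul, act_mul, dualIdem_of_mem_dualPart hv] at h3
  rw [level_two_zero hG.1 hv2, h2] at h1
  push_cast
  linear_combination (norm := module) h1

end Ladder

/-! ### Solving the recurrence by the values P_i(ψ). -/

section Solutions

set_option linter.unusedSectionVars false

variable {X : Type*} [Fintype X] [DecidableEq X] {G : SimpleGraph X}

/-- The coefficient `k_i b_i b_{i+1}`. -/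
noncomputable def kbb (G : SimpleGraph X) (i : ℕ) : ℝ :=
  (kk G i : ℝ) * (b G i : ℝ) * (b G (i + 1) : ℝ)

/-- The ratio of `E*_{m+2} A_{m+4} v` to `E*_{m+2} A_m v`, for `ψ = s`. -/
noncomputable def ratio (G : SimpleGraph X) (s : ℝ) (m : ℕ) : ℝ :=
  b G (m + 2) * b G (m + 3) / (c G (m + 1) * c G (m + 2)) *
    ((P G m).eval s / (P G (m + 2)).eval s)

/-- The coefficient of `E*_{m+2} A_m v` in `A E*_{m+3} A_{m+1} v`, for `ψ = s`. -/
noncomputable def lowering (G : SimpleGraph X) (s : ℝ) (m : ℕ) : ℝ :=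
  b G (m + 2) * c G (m + 3) / c G (m + 1) *
    ((P G (m + 3)).eval s * (P G m).eval s / ((P G (m + 2)).eval s * (P G (m + 1)).eval s))

theorem c_ne_zero (hG : IsDistanceRegular G) {i : ℕ} (h0 : i ≠ 0) (hi : i ≤ G.diam) :
    (c G i : ℝ) ≠ 0 := by
  exact_mod_cast (c_pos hG h0 hi).ne'

theorem b_ne_zero (hG : IsDistanceRegular G) {i : ℕ} (hi : i < G.diam) : (b G i : ℝ) ≠ 0 := by
  exact_mod_cast (b_pos hG hi).ne'

theorem kk_ne_zero (hG : IsDistanceRegular G) {i : ℕ} (hi : i ≤ G.diam) : (kk G i : ℝ) ≠ 0 := by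
  exact_mod_cast (kk_pos hG hi).ne'

theorem kbb_ne_zero (hG : IsDistanceRegular G) {i : ℕ} (hi : i + 2 ≤ G.diam) : kbb G i ≠ 0 :=
  mul_ne_zero (mul_ne_zero (kk_ne_zero hG (by omega)) (b_ne_zero hG (by omega)))
    (b_ne_zero hG (by omega))

theorem kbb_zero (hG : IsDistanceRegular G) : kbb G 0 = valency G * b G 1 := by
  rw [kbb, kk_zero hG, valency, Nat.cast_one, one_mul]

theorem c_mul_kbb_succ (hG : IsDistanceRegular G) (hb : G.IsBipartite)
    (hD : 1 ≤ G.diam) (i : ℕ) : (c G (i + 1) : ℝ) * kbb G (i + 1) = b G (i + 2) * kbb G i := by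
  have h : (kk G i : ℝ) * b G i = kk G (i + 1) * c G (i + 1) := by
    exact_mod_cast kk_mul_b hG hb hD i
  rw [kbb, kbb]
  linear_combination (-(b G (i + 1) : ℝ) * b G (i + 2)) * h

theorem eval_parity_mul_P (hG : IsDistanceRegular G) (hb : G.IsBipartite) {i : ℕ}
    (hi : i + 2 ≤ G.diam) (s : ℝ) :
    (if Even i then s else 1) * (P G (i + 1)).eval s =
      c G (i + 2) * (P G (i + 2)).eval s + b G (i + 2) * (P G i).eval s := by
  have h := congrArg (eval s) (parity_mul_P hG hb hi)
  rw [eval_mul, eval_add, eval_mul, eval_mul, eval_C, eval_C] at h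
  rw [← h]
  split_ifs <;> simp

theorem lowering_eq (hG : IsDistanceRegular G) (hb : G.IsBipartite) {s : ℝ}
    (hP : ∀ i ≤ G.diam, (P G i).eval s ≠ 0) {m : ℕ} (hm : m + 3 ≤ G.diam) :
    lowering G s m =
      b G (m + 2) + c G m * ratio G s (m - 1) - c G (m + 2) * ratio G s m := by
  have hP2 := hP (m + 2) (by omega)
  have hc1 := c_ne_zero hG (i := m + 1) (by omega) (by omega)
  have hc2 := c_ne_zero hG (i := m + 2) (by omega) (by omega)
  rcases m with _ | m
  · have h1 := eval_parity_mul_P hG hb (i := 1) hm s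
    rw [lowering, c_zero, Nat.cast_zero, zero_mul, add_zero, ratio, P_zero]
    simp only [zero_add, Nat.reduceAdd] at *
    rw [P_one hG (by omega), c_one hG (by omega)] at *
    simp only [Nat.not_even_one, if_false, one_mul, eval_one, mul_one, Nat.cast_one] at *
    field_simp
    linear_combination (-(b G 2 : ℝ)) * h1
  · have h1 := eval_parity_mul_P hG hb (i := m) (by omega) s
    have h2 := eval_parity_mul_P hG hb (i := m + 2) hm s
    have hP3 := hP (m + 2) (by omega)
    have hc3 := c_ne_zero hG (i := m + 1) (by omega) (by omega)
    -- The two recurrences carry the same parity factor, so it is eliminated by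
    -- cross-multiplication.
    have h4 : Even (m + 2) ↔ Even m := by grind
    simp only [h4] at h2
    rw [lowering, ratio, ratio, Nat.add_sub_cancel]
    simp only [add_assoc, Nat.reduceAdd] at *
    field_simp
    linear_combination (b G (m + 3) * (P G (m + 3)).eval s) * h1 -
      (b G (m + 3) * (P G (m + 1)).eval s) * h2

theorem ratio_succ_mul_lowering (hG : IsDistanceRegular G) {s : ℝ}
    (hP : ∀ i ≤ G.diam, (P G i).eval s ≠ 0) {m : ℕ} (hm : m + 3 ≤ G.diam) :
    ratio G s (m + 1) * lowering G s m = b G (m + 4) * ratio G s m := by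
  have hP1 := hP (m + 1) (by omega)
  have hP2 := hP (m + 2) (by omega)
  have hP3 := hP (m + 3) (by omega)
  have hc1 := c_ne_zero hG (i := m + 1) (by omega) (by omega)
  have hc2 := c_ne_zero hG (i := m + 2) (by omega) (by omega)
  have hc3 := c_ne_zero hG (i := m + 3) (by omega) (by omega)
  rw [lowering, ratio, ratio]
  simp only [add_assoc, Nat.reduceAdd] at *
  field_simp

theorem lowering_ne_zero (hG : IsDistanceRegular G) {s : ℝ}
    (hP : ∀ i ≤ G.diam, (P G i).eval s ≠ 0) {m : ℕ} (hm : m + 3 ≤ G.diam) :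
    lowering G s m ≠ 0 :=
  mul_ne_zero (div_ne_zero (mul_ne_zero (b_ne_zero hG (by omega)) (c_ne_zero hG (by omega) hm))
      (c_ne_zero hG (by omega) (by omega)))
    (div_ne_zero (mul_ne_zero (hP _ hm) (hP _ (by omega)))
      (mul_ne_zero (hP _ (by omega)) (hP _ (by omega))))

theorem c_mul_c_mul_kbb_add_two (hG : IsDistanceRegular G) (hb : G.IsBipartite)
    (hD : 1 ≤ G.diam) (i : ℕ) :
    (c G (i + 1) : ℝ) * c G (i + 2) * kbb G (i + 2) = b G (i + 2) * b G (i + 3) * kbb G i := by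
  have h1 := c_mul_kbb_succ hG hb hD i
  have h2 := c_mul_kbb_succ hG hb hD (i + 1)
  linear_combination (c G (i + 1) : ℝ) * h2 + (b G (i + 3) : ℝ) * h1

/-- In terms of the weights k_i b_i b_{i+1} the ratio is a quotient of values two indices apart, so
products of successive ratios telescope. -/
theorem ratio_eq (hG : IsDistanceRegular G) (hb : G.IsBipartite) {s : ℝ} {m : ℕ} (hm : m + 2 ≤ G.diam) :
    ratio G s m = (P G m).eval s / (P G (m + 2)).eval s * (kbb G (m + 2) / kbb G m) := by
  have h := c_mul_c_mul_kbb_add_two hG hb (by omega) m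
  have hk := kbb_ne_zero hG hm
  have hc1 := c_ne_zero hG (i := m + 1) (by omega) (by omega)
  have hc2 := c_ne_zero hG (i := m + 2) (by omega) (by omega)
  have h2 : (b G (m + 2) : ℝ) * b G (m + 3) / (c G (m + 1) * c G (m + 2)) =
      kbb G (m + 2) / kbb G m := by
    rw [div_eq_div_iff (mul_ne_zero hc1 hc2) hk]
    linear_combination -h
  rw [ratio, h2, mul_comm]

theorem c_two_mul_eval_P_two (hG : IsDistanceRegular G) (hb : G.IsBipartite) (hD : 2 ≤ G.diam)
    (s : ℝ) : (c G 2 : ℝ) * (P G 2).eval s = s - b G 2 := by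
  have h1 := congrArg (eval s) (c_mul_P_two hG hb hD)
  simpa using h1

theorem psi_sub_b_two (η : ℝ) : psi G η - b G 2 = -(b G 2 * b G 3 / (1 + η)) := by
  rw [psi]
  ring

/-- The initial condition of the recurrence; ψ is defined so that it holds, through c_2 P_2(ψ) = ψ -
b_2. -/
theorem ratio_psi_zero (hG : IsDistanceRegular G) (hb : G.IsBipartite) (hD : 4 ≤ G.diam) {η : ℝ}
    (hη : η ≠ -1) : ratio G (psi G η) 0 = -(1 + η) := by
  have h1 := c_two_mul_eval_P_two hG hb (by omega) (psi G η)
  have h2 : 1 + η ≠ 0 := fun h => hη (by linarith)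
  have hc2 := c_ne_zero hG (i := 2) (by omega) (by omega)
  rw [psi_sub_b_two] at h1
  rw [ratio, P_zero, eval_one]
  simp only [zero_add]
  rw [c_one hG (by omega), Nat.cast_one, one_mul, div_mul_div_comm, mul_one, h1, div_neg, neg_inj]
  have hb2 := b_ne_zero hG (i := 2) (by omega)
  have hb3 := b_ne_zero hG (i := 3) (by omega)
  field_simp

variable {x : X} {W : Submodule ℂ (EuclideanSpace ℂ X)}

/-- The expansion in the vectors `p_h(A) v`. -/
theorem level_eq_sum (hG : IsDistanceRegular G) (hb : G.IsBipartite) (hD : 1 ≤ G.diam)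
    (hW : IsTModule G x W) (hend : endpoint G x W = 2) {v : EuclideanSpace ℂ X}
    (hv : v ∈ dualPart G x 2 W) {s : ℝ} (hP : ∀ i ≤ G.diam, (P G i).eval s ≠ 0)
    (hr : ∀ m, m + 2 ≤ G.diam →
      level G x v (m + 2) (m + 4) = (ratio G s m : ℂ) • level G x v (m + 2) m) :
    ∀ {i : ℕ}, i + 2 ≤ G.diam → level G x v (i + 2) i =
      ∑ h ∈ (Finset.range (i + 1)).filter (fun h => Even (i - h)),
        (((P G h).eval s / (P G i).eval s * (kbb G i / kbb G h) : ℝ) : ℂ) • act (pA G h) v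
  | 0, hi => by
    have h1 := act_pA hG hb hD hW hend hv 0
    rw [level_eq_zero_of_lt_two hG hb hD hW hend (dualPart_le hW 2 hv) two_pos, sub_zero] at h1
    have hk : kbb G 0 ≠ 0 := kbb_ne_zero hG hi
    simp [← h1, hk, P_zero]
  | 1, hi => by
    have h1 := act_pA hG hb hD hW hend hv 1
    rw [level_eq_zero_of_lt_two hG hb hD hW hend (dualPart_le hW 2 hv) one_lt_two, sub_zero] at h1
    have hk : kbb G 1 ≠ 0 := kbb_ne_zero hG hi
    rw [← h1, Finset.sum_filter, Finset.sum_range_succ, Finset.sum_range_one]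
    simp [div_self hk, P_one hG hD]
  | i + 2, hi => by
    have h1 := act_pA hG hb hD hW hend hv (i + 2)
    have h2 := hr i (by omega)
    have h3 := level_eq_sum hG hb hD hW hend hv hP hr (i := i) (by omega)
    have hk := kbb_ne_zero hG hi
    have hPi := hP (i + 2) (by omega)
    -- Solving the formula for p_{i+2}(A)v for its upper term reduces the expansion at i + 2 to the
    -- one at i.
    have h4 : level G x v (i + 2 + 2) (i + 2) =
        (ratio G s i : ℂ) • level G x v (i + 2) i + act (pA G (i + 2)) v := by
      rw [h1, ← h2]
      abel
    rw [h4, h3, sum_filter_even_succ_succ, div_self hk, div_self hPi, mul_one, Complex.ofReal_one,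
      one_smul, Finset.smul_sum]
    congr 1
    refine Finset.sum_congr rfl fun h _ => ?_
    rw [smul_smul, ratio_eq hG hb (by omega), ← Complex.ofReal_mul]
    congr 2
    have hk0 := kbb_ne_zero hG (i := i) (by omega)
    have hP0 := hP i (by omega)
    field_simp

theorem norm_sq_level (hG : IsDistanceRegular G) (hb : G.IsBipartite) (hD : 4 ≤ G.diam)
    {v : EuclideanSpace ℂ X} (hv : ∀ y, G.dist x y ≠ 2 → v y = 0)
    {s : ℝ} (hs : s ≠ b G 2) (hP : ∀ i ≤ G.diam, (P G i).eval s ≠ 0)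
    (hr : ∀ m, m + 3 ≤ G.diam → c G (m + 1) * ‖level G x v (m + 3) (m + 1)‖ ^ 2 =
      lowering G s m * ‖level G x v (m + 2) m‖ ^ 2) {i : ℕ} (hi : i + 2 ≤ G.diam) :
    ‖level G x v (i + 2) i‖ ^ 2 = kbb G i * c G (i + 1) * c G (i + 2) /
      (valency G * b G 1 * (s - b G 2)) * ((P G (i + 2)).eval s / (P G i).eval s) * ‖v‖ ^ 2 := by
  have hs' : s - b G 2 ≠ 0 := sub_ne_zero.2 hs
  have hkb : (valency G : ℝ) * b G 1 ≠ 0 := by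
    rw [← kbb_zero hG]
    exact kbb_ne_zero hG (by omega)
  induction i with
  | zero =>
    -- At i = 0 the factor c_2 P_2(s) = s - b_2 cancels the denominator, which explains the
    -- normalisation.
    have h1 := c_two_mul_eval_P_two hG hb (by omega) s
    rw [kbb_zero hG, P_zero, eval_one, div_one]
    simp only [zero_add]
    rw [level_two_zero hG.1 hv, c_one hG (by omega), Nat.cast_one, mul_one, div_mul_eq_mul_div,
      mul_assoc (_ * _) (c G 2 : ℝ), h1, div_self (mul_ne_zero hkb hs'), one_mul]
  | succ i ih =>
    have h1 := hr i (by omega)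
    have h2 := c_mul_kbb_succ hG hb (by omega) i
    have hc1 := c_ne_zero hG (i := i + 1) (by omega) (by omega)
    have hP0 := hP i (by omega)
    have hP1 := hP (i + 1) (by omega)
    have hP2 := hP (i + 2) (by omega)
    have h3 : kbb G (i + 1) = b G (i + 2) * kbb G i / c G (i + 1) := by
      rw [eq_div_iff hc1]
      linear_combination h2
    rw [ih (by omega), lowering] at h1
    apply mul_left_cancel₀ hc1
    rw [h3]
    refine h1.trans ?_
    have hv1 := left_ne_zero_of_mul hkb
    have hv2 := right_ne_zero_of_mul hkb
    simp only [add_assoc, Nat.reduceAdd]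
    field_simp

theorem norm_sq_level_of_eq_neg_one (hG : IsDistanceRegular G) (hb : G.IsBipartite)
    (hD : 4 ≤ G.diam) {v : EuclideanSpace ℂ X} (hv : ∀ y, G.dist x y ≠ 2 → v y = 0)
    (hr : ∀ m, m + 3 ≤ G.diam → c G (m + 1) * ‖level G x v (m + 3) (m + 1)‖ ^ 2 =
      b G (m + 2) * ‖level G x v (m + 2) m‖ ^ 2) {i : ℕ} (hi : i + 2 ≤ G.diam) :
    ‖level G x v (i + 2) i‖ ^ 2 = kbb G i / (valency G * b G 1) * ‖v‖ ^ 2 := by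
  have hkb : (valency G : ℝ) * b G 1 ≠ 0 := by
    rw [← kbb_zero hG]
    exact kbb_ne_zero hG (by omega)
  induction i with
  | zero =>
    rw [kbb_zero hG, zero_add, level_two_zero hG.1 hv, div_self hkb, one_mul]
  | succ i ih =>
    have h1 := hr i (by omega)
    have h2 := c_mul_kbb_succ hG hb (by omega) i
    have hc1 := c_ne_zero hG (i := i + 1) (by omega) (by omega)
    rw [ih (by omega)] at h1
    apply mul_left_cancel₀ hc1
    refine h1.trans ?_
    rw [← mul_assoc, ← mul_assoc, ← mul_div_assoc, ← mul_div_assoc, h2]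

end Solutions

end DRG

/-! ### Assembly of the two cases. -/

theorem mainTheorem6 {X : Type*} [Fintype X] [DecidableEq X]
    (G : SimpleGraph X) (hG : DRG.IsDistanceRegular G) (hbip : G.IsBipartite)
    (hD : 4 ≤ G.diam) (hk : 3 ≤ DRG.valency G) (x : X)
    (W : Submodule ℂ (EuclideanSpace ℂ X))
    (hW : DRG.IsIrreducibleTModule G x W) (hthin : DRG.IsThin G x W)
    (hend : DRG.endpoint G x W = 2)
    (η : ℝ) (hη : DRG.IsLocalEigenvalue G x W η)
    (hη₁ : DRG.tilde G (DRG.theta G 1) < η)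
    (hη₂ : η < DRG.tilde G (DRG.theta G (G.diam / 2)))
    (v : EuclideanSpace ℂ X) (hv : v ∈ DRG.dualPart G x 2 W) (hv0 : v ≠ 0) :
    -- the vectors form a basis of `W`
    (LinearIndependent ℂ (fun i : Fin (G.diam - 1) => DRG.vec G x v i) ∧
      Submodule.span ℂ (Set.range fun i : Fin (G.diam - 1) => DRG.vec G x v i) = W) ∧
    -- they are mutually orthogonal
    (∀ i j : ℕ, i ≤ G.diam - 2 → j ≤ G.diam - 2 → i ≠ j →
      inner ℂ (DRG.vec G x v i) (DRG.vec G x v j) = 0) ∧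
    -- explicit form and square-norms for `η ≠ -1`
    (η ≠ -1 →
      DRG.psi G η ≠ (DRG.b G 2 : ℝ) ∧
      (∀ i ≤ G.diam, (DRG.P G i).eval (DRG.psi G η) ≠ 0) ∧
      ∀ i ≤ G.diam - 2,
        DRG.vec G x v i =
          ∑ h ∈ (Finset.range (i + 1)).filter (fun h => Even (i - h)),
            (((DRG.P G h).eval (DRG.psi G η) / (DRG.P G i).eval (DRG.psi G η) *
              ((DRG.kk G i : ℝ) * (DRG.b G i : ℝ) * (DRG.b G (i + 1) : ℝ) /
                ((DRG.kk G h : ℝ) * (DRG.b G h : ℝ) * (DRG.b G (h + 1) : ℝ))) : ℝ) : ℂ) •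
              DRG.act (DRG.pA G h) v ∧
        ‖DRG.vec G x v i‖ ^ 2 =
          (DRG.kk G i : ℝ) * (DRG.b G i : ℝ) * (DRG.b G (i + 1) : ℝ) *
              (DRG.c G (i + 1) : ℝ) * (DRG.c G (i + 2) : ℝ) /
            ((DRG.valency G : ℝ) * (DRG.b G 1 : ℝ) * (DRG.psi G η - (DRG.b G 2 : ℝ))) *
            ((DRG.P G (i + 2)).eval (DRG.psi G η) / (DRG.P G i).eval (DRG.psi G η)) *
            ‖v‖ ^ 2) ∧
    -- explicit form and square-norms for `η = -1`
    (η = -1 →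
      ∀ i ≤ G.diam - 2,
        DRG.vec G x v i = DRG.act (DRG.pA G i) v ∧
        ‖DRG.vec G x v i‖ ^ 2 =
          (DRG.kk G i : ℝ) * (DRG.b G i : ℝ) * (DRG.b G (i + 1) : ℝ) /
            ((DRG.valency G : ℝ) * (DRG.b G 1 : ℝ)) * ‖v‖ ^ 2) := by
  have hv2 := DRG.apply_eq_zero_of_mem_dualPart hv
  have hT := hW.1
  have h24 := DRG.level_two_four hG hbip (by omega) hT hend hv hη
  have main : (∀ m, m + 2 ≤ G.diam → DRG.level G x v (m + 2) m ≠ 0) ∧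
      (η ≠ -1 → DRG.psi G η ≠ (DRG.b G 2 : ℝ) ∧
        (∀ i ≤ G.diam, (DRG.P G i).eval (DRG.psi G η) ≠ 0) ∧
        (∀ m, m + 2 ≤ G.diam → DRG.level G x v (m + 2) (m + 4) =
          (DRG.ratio G (DRG.psi G η) m : ℂ) • DRG.level G x v (m + 2) m) ∧
        ∀ m, m + 3 ≤ G.diam → DRG.c G (m + 1) * ‖DRG.level G x v (m + 3) (m + 1)‖ ^ 2 =
          DRG.lowering G (DRG.psi G η) m * ‖DRG.level G x v (m + 2) m‖ ^ 2) ∧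
      (η = -1 →
        (∀ m, m + 2 ≤ G.diam → DRG.level G x v (m + 2) (m + 4) = 0) ∧
        ∀ m, m + 3 ≤ G.diam → DRG.c G (m + 1) * ‖DRG.level G x v (m + 3) (m + 1)‖ ^ 2 =
          DRG.b G (m + 2) * ‖DRG.level G x v (m + 2) m‖ ^ 2) := by
    by_cases h : η = -1
    -- The degenerate case, with ψ at infinity: g_0 = 0 forces every ratio to be 0, and B_m reduces
    -- to b_{m+2}.
    · have hl := DRG.ladder hG hbip (by omega) hT hthin hend hv hv0 (g := fun _ => 0)
        (B := fun m => DRG.b G (m + 2)) (by rw [h24, h]; simp) (by simp)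
        (fun m hm => DRG.b_ne_zero hG (by omega)) (by simp)
      exact ⟨fun m hm => (hl m hm).1, fun h' => absurd h h',
        fun _ => ⟨fun m hm => by simpa using (hl m hm).2.1,
          fun m hm => (hl m (by omega)).2.2 hm⟩⟩
    · have hout := DRG.psi_outside hG hbip hD hη₁ hη₂ h
      have hP := fun i hi => DRG.eval_P_ne_zero hG hbip (by omega) (i := i) hi hout
      have hl := DRG.ladder hG hbip (by omega) hT hthin hend hv hv0
        (g := DRG.ratio G (DRG.psi G η)) (B := DRG.lowering G (DRG.psi G η))
        (by rw [h24, DRG.ratio_psi_zero hG hbip hD h])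
        (fun m hm => DRG.lowering_eq hG hbip hP hm) (fun m hm => DRG.lowering_ne_zero hG hP hm)
        (fun m hm => DRG.ratio_succ_mul_lowering hG hP hm)
      refine ⟨fun m hm => (hl m hm).1, fun _ => ⟨?_, hP, fun m hm => (hl m hm).2.1,
        fun m hm => (hl m (by omega)).2.2 hm⟩, fun h' => absurd h' h⟩
      rw [← sub_ne_zero, DRG.psi_sub_b_two, neg_ne_zero]
      exact div_ne_zero (mul_ne_zero (DRG.b_ne_zero hG (by omega)) (DRG.b_ne_zero hG (by omega)))
        fun h' => h (by linarith)
  obtain ⟨hne, hpsi, hneg⟩ := main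
  refine ⟨DRG.linearIndependent_and_span_eq hG hbip (by omega) hT hthin hend hv hne, ?_, ?_, ?_⟩
  · intro i j _ _ hij
    rw [DRG.vec_eq_level, DRG.vec_eq_level]
    exact DRG.inner_level_of_ne x v v (by omega)
  · intro h
    obtain ⟨h1, hP, h2, h3⟩ := hpsi h
    refine ⟨h1, hP, fun i hi => ?_⟩
    rw [DRG.vec_eq_level]
    exact ⟨DRG.level_eq_sum hG hbip (by omega) hT hend hv hP h2 (by omega),
      DRG.norm_sq_level hG hbip hD hv2 h1 hP h3 (by omega)⟩
  · intro h i hi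
    obtain ⟨h1, h2⟩ := hneg h
    rw [DRG.vec_eq_level]
    refine ⟨?_, DRG.norm_sq_level_of_eq_neg_one hG hbip hD hv2 h2 (by omega)⟩
    rw [DRG.act_pA hG hbip (by omega) hT hend hv]
    -- Below level 2 this is the endpoint condition; from level 2 on it is the vanishing of the
    -- ratios.
    have h3 : DRG.level G x v i (i + 2) = 0 := by
      rcases Nat.lt_or_ge i 2 with h4 | h4
      · exact DRG.level_eq_zero_of_lt_two hG hbip (by omega) hT hend (DRG.dualPart_le hT 2 hv) h4 _
      · obtain ⟨m, rfl⟩ := Nat.exists_eq_add_of_le' h4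
        exact h1 m (by omega)
    rw [h3, sub_zero]
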